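/- Let $\alpha\in[0,1)$. For a finite simple graph $G$ let $\rho_\alpha(G)$ denote its $\alpha$-spectral radius, that is, the spectral radius of $A_\alpha(G)=\alpha D(G)+(1-\alpha)A(G)$, where $A(G)$ is the adjacency matrix and $D(G)$ the diagonal matrix of vertex degrees. Let $\Theta$ be the graph $K_4-e$ with vertices $w_1,w_2,w_3,w_4$, where $w_1,w_3$ are the two non-adjacent vertices (of degree $2$) and $w_2,w_4$ have degree $3$. For integers $s,a,b\ge 0$ let - $\Theta_1(s;a,b)$ be the graph obtained from $\Theta$ by attaching $s$ pendant edges and two pendant paths of lengths $a$ and $b$ to $w_1$; - $\Theta_2(s;a,b)$ be the graph obtained from $\Theta$ by attaching $s$ pendant edges and two pendant paths of lengths $a$ and $b$ to $w_2$; - $\Theta_3(s;a,b)$ be the graph obtained from $\Theta$ by attaching $s$ pendant edges and a pendant path of length $a$ to $w_2$, and a pendant path of length $b$ to $w_4$. (A pendant path of length $\ell$ adds $\ell$ new vertices; for $\ell=0$ nothing is attached.) Let $\Theta_i(n,d)$ be the set of all graphs $\Theta_i(s;a,b)$ with $n$ vertices and diameter $d$. For $d\ge 2$ and $n\ge d+3$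 let $B_3^*(n,d)$ be the graph $\Theta_3(s;a,b)$ on $n$ vertices with $0\le a-b\le 1$ and $d=a+b+1$; explicitly $s=n-d-3$, $a=\lceil (d-1)/2\rceil$, $b=\lfloor (d-1)/2\rfloor$. Then, for all $d\ge 2$ and $n\ge d+3$, the graph $B_3^*(n,d)$ belongs to $\Theta_3(n,d)$, and it is, up to isomorphism, the unique graph with maximal $\alpha$-spectral radius in $\Theta_1(n,d)\cup\Theta_2(n,d)\cup\Theta_3(n,d)$: every graph $G$ in this union satisfies $\rho_\alpha(G)\le\rho_\alpha(B_3^*(n,d))$, with equality if and only if $G\cong B_3^*(n,d)$. -/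

import Mathlib

open scoped ENNReal

/-- The matrix `A_α(G) = α D(G) + (1 - α) A(G)`. -/
noncomputable def alphaMatrix {V : Type*} [Fintype V] (α : ℝ) (G : SimpleGraph V) :
    Matrix V V ℝ :=
  open Classical in α • G.degMatrix ℝ + (1 - α) • G.adjMatrix ℝ

/-- The `α`-spectral radius of `G`: the largest absolute value of an eigenvalue of `A_α(G)`.
As `A_α(G)` is a real symmetric matrix, all its eigenvalues are real. -/
noncomputable def alphaSpectralRadius {V : Type*} [Fintype V] (α : ℝ) (G : SimpleGraph V) :
    ℝ≥0∞ :=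
  open Classical in spectralRadius ℝ (alphaMatrix α G)

/-- Attach `s` pendant edges to the vertex `v`: the `s` new vertices are all joined to `v`. -/
def attachPendants {V : Type*} (G : SimpleGraph V) (v : V) (s : ℕ) :
    SimpleGraph (V ⊕ Fin s) where
  Adj
    | .inl x, .inl y => G.Adj x y
    | .inl x, .inr _ => x = v
    | .inr _, .inl y => y = v
    | .inr _, .inr _ => False
  symm := ⟨by rintro (x | i) (y | j) h <;> first | exact SimpleGraph.Adj.symm (G := G) h | exact h⟩
  loopless := ⟨by rintro (x | i) h <;> first | exact G.irrefl h | exact h⟩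

/-- Attach a pendant path of length `l` (so with `l` new vertices) to the vertex `v`: the new
vertices `0, 1, …, l - 1` form a path in this order, and `v` is joined to `0`. -/
def attachPath {V : Type*} (G : SimpleGraph V) (v : V) (l : ℕ) :
    SimpleGraph (V ⊕ Fin l) where
  Adj
    | .inl x, .inl y => G.Adj x y
    | .inl x, .inr j => x = v ∧ (j : ℕ) = 0
    | .inr i, .inl y => y = v ∧ (i : ℕ) = 0
    | .inr i, .inr j => (i : ℕ) + 1 = j ∨ (j : ℕ) + 1 = i
  symm := ⟨by rintro (x | i) (y | j) h <;> first | exact SimpleGraph.Adj.symm (G := G) h | exact h | exact h.symm⟩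
  loopless := ⟨by rintro (x | i) h <;> first | exact G.irrefl h | (simp at h)⟩

/-- The bicyclic graph `K₄ - e` on four vertices. With `w₁, w₂, w₃, w₄` standing for
`0, 1, 2, 3`, the missing edge is `w₁w₃`, so `w₁, w₃` have degree 2 and `w₂, w₄` degree 3. -/
def diamond : SimpleGraph (Fin 4) :=
  (⊤ : SimpleGraph (Fin 4)).deleteEdges {s(0, 2)}

/-- The vertices of the graphs `Θᵢ(s; a, b)`: those of `K₄ - e`, the `s` pendant vertices and the
new vertices of the two pendant paths. -/
abbrev ThetaVertex (s a b : ℕ) : Type := ((Fin 4 ⊕ Fin s) ⊕ Fin a) ⊕ Fin b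

/-- The graph obtained from `K₄ - e` by attaching `s` pendant edges and a pendant path of length
`a` to `u`, and a pendant path of length `b` to `v`. -/
def thetaGraph (u v : Fin 4) (s a b : ℕ) : SimpleGraph (ThetaVertex s a b) :=
  attachPath (attachPath (attachPendants diamond u s) (.inl u) a) (.inl (.inl v)) b

/-- `Θ₁(s; a, b)`: the `s` pendant edges and both pendant paths are attached to `w₁`. -/
def theta₁ (s a b : ℕ) : SimpleGraph (ThetaVertex s a b) := thetaGraph 0 0 s a b

/-- `Θ₂(s; a, b)`: the `s` pendant edges and both pendant paths are attached to `w₂`. -/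
def theta₂ (s a b : ℕ) : SimpleGraph (ThetaVertex s a b) := thetaGraph 1 1 s a b

/-- `Θ₃(s; a, b)`: the `s` pendant edges and the pendant path of length `a` are attached to `w₂`,
the pendant path of length `b` to `w₄`. -/
def theta₃ (s a b : ℕ) : SimpleGraph (ThetaVertex s a b) := thetaGraph 1 3 s a b

/-- `G` belongs (up to isomorphism) to the set of those graphs `Θ(s; a, b)` of the family `Θ` that
have `n` vertices and diameter `d`. -/
def InFamily (Θ : (s a b : ℕ) → SimpleGraph (ThetaVertex s a b)) (n d : ℕ)
    {V : Type*} [Fintype V] (G : SimpleGraph V) : Prop :=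
  Fintype.card V = n ∧ G.diam = d ∧ ∃ s a b : ℕ, Nonempty (G ≃g Θ s a b)

/-- `G` belongs (up to isomorphism) to the union of the three families of graphs `Θ₁(s; a, b)`,
`Θ₂(s; a, b)`, `Θ₃(s; a, b)` with `n` vertices and diameter `d`. -/
def InTheta (n d : ℕ) {V : Type*} [Fintype V] (G : SimpleGraph V) : Prop :=
  InFamily theta₁ n d G ∨ InFamily theta₂ n d G ∨ InFamily theta₃ n d G

/-- The graph `B₃*(n, d)`, for `2 ≤ d` and `d + 3 ≤ n`: the graph `Θ₃(s; a, b)` on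
`n = s + a + b + 4` vertices with `0 ≤ a - b ≤ 1` and `d = a + b + 1`, that is, with
`s = n - d - 3`, `a = ⌈(d - 1) / 2⌉` and `b = ⌊(d - 1) / 2⌋`. -/
def B₃Star (n d : ℕ) : SimpleGraph (ThetaVertex (n - (d + 3)) (d / 2) ((d - 1) / 2)) :=
  theta₃ (n - (d + 3)) (d / 2) ((d - 1) / 2)

/-- The parameters of `B₃Star` are the only ones that meet its defining conditions. -/
theorem B₃Star_parameters {n d : ℕ} (hd : 2 ≤ d) (hn : d + 3 ≤ n) (s a b : ℕ) :
    (s = n - (d + 3) ∧ a = d / 2 ∧ b = (d - 1) / 2) ↔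
      (n = s + a + b + 4 ∧ d = a + b + 1 ∧ b ≤ a ∧ a ≤ b + 1) := by
  omega

/-! Fix `r > 2`. Along a pendant path the equation `A_α x = r x` can be solved from the free end to
the root, so a path of length `k` acts on its root only as an extra diagonal weight `f_k =
pathWeight α r k`; a pendant edge acts as `f_1`. If nothing is attached to `w₁, w₃`, these are
eliminated as well. With `t = coreShift`, `K = coreGap` and weights `P, Q` attached to `w₂, w₄`,
there remains `(K - P) y₂ = (1 - α + t) y₄`, `(K - Q) y₄ = (1 - α + t) y₂`. So the Perron root of a
graph `Θ₃` satisfies `(K - P)(K - Q) = (1 - α + t)²` (`exists_perron_theta₃`). Conversely, if `P <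
K` and the product is strictly larger at some `r`, there is a positive `x` with `A_α x ≤ r x`, not
an equality, and the spectral radius is below `r` (`alphaSpectralRadius_lt_of_supersolution`).

Hence all comparisons are inequalities between weights at one value `r`, the Perron root of `B₃*`.
Within `Θ₃`, the recursion for `f_k` is a contraction, so lengthening the longer path adds less
weight than shortening the other one removes (`lt_mul_of_unbalanced`). `Θ₂(s; a, b)` with `b ≥ 2` is
compared with `Θ₃(s + 1; a, b - 1)` (`theta₂_weights_lt`). For `Θ₁` with two paths of length at
least 2, moving all attachments from `w₂` to `w₁` lowers the radius further
(`two_mul_sq_lt_of_sq_le`); otherwise it is compared with a graph `Θ₃(S; m + 1, 1)`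
(`two_mul_sq_lt_of_sq_le_pendant`).

The diameter formulas determine which parameters compete. Isomorphisms arise only from exchanging
the paths of `Θ₃(0; a, b)` or of `Θ₂`, from reading a path of length 1 as a pendant edge, and from
an empty path, whose root is immaterial. -/

/-- `∑_{w ∼ v} (α x_v + (1 - α) x_w)`, the `v`-th coordinate of `A_α(G) x`. -/
noncomputable def edgeSum {V : Type*} [Fintype V] (α : ℝ) (G : SimpleGraph V) (x : V → ℝ)
    (v : V) : ℝ :=
  open Classical in ∑ w, if G.Adj v w then α * x v + (1 - α) * x w else 0

/-! ### Perron–Frobenius theory for `A_α(G)` -/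

section Spectral

variable {V : Type*} [Fintype V] {α : ℝ} {G : SimpleGraph V}

theorem alphaMatrix_mulVec (x : V → ℝ) :
    (alphaMatrix α G).mulVec x = edgeSum α G x := by
  classical
  ext v
  simp only [alphaMatrix, edgeSum, Matrix.add_mulVec, Matrix.smul_mulVec, Pi.add_apply,
    Pi.smul_apply, smul_eq_mul]
  rw [← Finset.sum_filter, Finset.sum_add_distrib, Finset.sum_const, ← Finset.mul_sum]
  congr 1
  · simp only [SimpleGraph.degMatrix, Matrix.mulVec_diagonal, nsmul_eq_mul,
      ← SimpleGraph.card_neighborFinset_eq_degree, SimpleGraph.neighborFinset_eq_filter]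
    convert mul_left_comm _ _ _ using 3
  · rw [SimpleGraph.adjMatrix_mulVec_apply, SimpleGraph.neighborFinset_eq_filter]

theorem alphaMatrix_transpose : (alphaMatrix α G).transpose = alphaMatrix α G := by
  classical
  simp [alphaMatrix, SimpleGraph.degMatrix]

theorem dotProduct_edgeSum_comm (x y : V → ℝ) :
    x ⬝ᵥ edgeSum α G y = edgeSum α G x ⬝ᵥ y := by
  rw [← alphaMatrix_mulVec, ← alphaMatrix_mulVec, Matrix.dotProduct_mulVec,
    ← Matrix.mulVec_transpose, alphaMatrix_transpose]

theorem abs_edgeSum_le (h0 : 0 ≤ α) (h1 : α < 1) (x : V → ℝ) (v : V) :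
    |edgeSum α G x v| ≤ edgeSum α G (fun w ↦ |x w|) v := by
  refine (Finset.abs_sum_le_sum_abs _ _).trans (Finset.sum_le_sum fun w _ ↦ ?_)
  split_ifs
  · refine (abs_add_le _ _).trans ?_
    rw [abs_mul, abs_mul, abs_of_nonneg h0, abs_of_nonneg (by linarith : (0 : ℝ) ≤ 1 - α)]
  · simp

/-- A nonnegative eigenvector of `A_α(G)` that vanishes at a vertex vanishes at its neighbours. -/
theorem eq_zero_of_adj (h0 : 0 ≤ α) (h1 : α < 1) {x : V → ℝ} (hx : ∀ v, 0 ≤ x v) {r : ℝ}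
    (hr : ∀ v, edgeSum α G x v = r * x v) {v w : V} (hv : x v = 0) (hvw : G.Adj v w) :
    x w = 0 := by
  classical
  have h := hr v
  rw [hv, mul_zero, edgeSum, Finset.sum_eq_zero_iff_of_nonneg] at h
  · have := h w (Finset.mem_univ _)
    rw [if_pos (by convert hvw), hv, mul_zero, zero_add, mul_eq_zero] at this
    exact this.resolve_left (by linarith)
  · intro u _
    split_ifs
    · have := mul_nonneg h0 (hx v)
      have := mul_nonneg (by linarith : (0 : ℝ) ≤ 1 - α) (hx u)
      linarith
    · exact le_rfl

theorem eq_zero_of_connected (h0 : 0 ≤ α) (h1 : α < 1) (hG : G.Connected) {x : V → ℝ}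
    (hx : ∀ v, 0 ≤ x v) {r : ℝ} (hr : ∀ v, edgeSum α G x v = r * x v) {v : V} (hv : x v = 0)
    (w : V) : x w = 0 := by
  obtain ⟨p⟩ := hG.preconnected v w
  induction p with
  | nil => exact hv
  | cons h _ ih => exact ih (eq_zero_of_adj h0 h1 hx hr hv h)

theorem exists_eigenvector_of_mem_spectrum {μ : ℝ}
    (h : μ ∈ open Classical in spectrum ℝ (alphaMatrix α G)) :
    ∃ z : V → ℝ, z ≠ 0 ∧ ∀ v, edgeSum α G z v = μ * z v := by
  classical
  rw [← Matrix.spectrum_toLin', ← Module.End.hasEigenvalue_iff_mem_spectrum] at h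
  obtain ⟨z, hz⟩ := h.exists_hasEigenvector
  refine ⟨z, hz.2, fun v ↦ ?_⟩
  have := hz.apply_eq_smul
  rw [Matrix.toLin'_apply, alphaMatrix_mulVec] at this
  rw [this]
  rfl

/-- An eigenvalue of `A_α(G)` is at most `r` in absolute value if `A_α(G) x ≤ r x` for some
positive vector `x`; if it is `± r`, then the absolute values of its eigenvector form an
eigenvector that is supported where `A_α(G) x = r x`. -/
theorem abs_eigenvalue_le_of_supersolution (h0 : 0 ≤ α) (h1 : α < 1) {x : V → ℝ}
    (hx : ∀ v, 0 < x v) {r : ℝ} (hr : ∀ v, edgeSum α G x v ≤ r * x v) {μ : ℝ} {z : V → ℝ}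
    (hz : z ≠ 0) (hμ : ∀ v, edgeSum α G z v = μ * z v) :
    |μ| ≤ r ∧ (|μ| = r → ∀ v, edgeSum α G (fun w ↦ |z w|) v = r * |z v| ∧
      (edgeSum α G x v < r * x v → z v = 0)) := by
  have habs : ∀ v, |μ| * |z v| ≤ edgeSum α G (fun w ↦ |z w|) v := fun v ↦ by
    rw [← abs_mul, ← hμ]
    exact abs_edgeSum_le h0 h1 z v
  have hpos : 0 < ∑ v, |z v| * x v := by
    obtain ⟨v, hv⟩ := Function.ne_iff.1 hz
    exact Finset.sum_pos' (fun w _ ↦ mul_nonneg (abs_nonneg _) (hx w).le)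
      ⟨v, Finset.mem_univ _, mul_pos (abs_pos.2 hv) (hx v)⟩
  -- Pairing with `x` and using symmetry: `|μ| ⟨|z|, x⟩ ≤ ⟨A|z|, x⟩ = ⟨|z|, A x⟩ ≤ r ⟨|z|, x⟩`. If
  -- `|μ| = r`, both inequalities are termwise equalities.
  have e1 : |μ| * ∑ v, |z v| * x v ≤ ∑ v, edgeSum α G (fun w ↦ |z w|) v * x v := by
    rw [Finset.mul_sum]
    refine Finset.sum_le_sum fun v _ ↦ ?_
    rw [← mul_assoc]
    exact mul_le_mul_of_nonneg_right (habs v) (hx v).le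
  have e2 : ∑ v, edgeSum α G (fun w ↦ |z w|) v * x v = ∑ v, |z v| * edgeSum α G x v :=
    (dotProduct_edgeSum_comm (α := α) (G := G) (fun w ↦ |z w|) x).symm
  have e3 : ∑ v, |z v| * edgeSum α G x v ≤ r * ∑ v, |z v| * x v := by
    rw [Finset.mul_sum]
    refine Finset.sum_le_sum fun v _ ↦ ?_
    rw [mul_left_comm]
    exact mul_le_mul_of_nonneg_left (hr v) (abs_nonneg _)
  refine ⟨le_of_mul_le_mul_right (e1.trans (e2.le.trans e3)) hpos, fun h v ↦ ⟨?_, fun hv ↦ ?_⟩⟩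
  · have hs : ∑ v, (edgeSum α G (fun w ↦ |z w|) v - |μ| * |z v|) * x v = 0 := by
      apply le_antisymm
      · simp only [sub_mul, Finset.sum_sub_distrib, mul_assoc, ← Finset.mul_sum]
        rw [e2, h]
        linarith
      · exact Finset.sum_nonneg fun v _ ↦ mul_nonneg (sub_nonneg.2 (habs v)) (hx v).le
    rw [Finset.sum_eq_zero_iff_of_nonneg
      fun v _ ↦ mul_nonneg (sub_nonneg.2 (habs v)) (hx v).le] at hs
    have := (mul_eq_zero.1 (hs v (Finset.mem_univ _))).resolve_right (hx v).ne'
    rw [← h]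
    linarith
  · have hn : ∀ v ∈ Finset.univ, 0 ≤ |z v| * (r * x v - edgeSum α G x v) :=
      fun v _ ↦ mul_nonneg (abs_nonneg _) (sub_nonneg.2 (hr v))
    have hs : ∑ v, |z v| * (r * x v - edgeSum α G x v) = 0 := by
      apply le_antisymm
      · simp only [mul_sub, Finset.sum_sub_distrib, mul_left_comm _ r, ← Finset.mul_sum]
        rw [h] at e1
        linarith
      · exact Finset.sum_nonneg hn
    rw [Finset.sum_eq_zero_iff_of_nonneg hn] at hs
    have := (mul_eq_zero.1 (hs v (Finset.mem_univ _))).resolve_right (by linarith)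
    exact abs_eq_zero.1 this

theorem ofReal_abs_le_alphaSpectralRadius {μ : ℝ} {z : V → ℝ} (hz : z ≠ 0)
    (hμ : ∀ v, edgeSum α G z v = μ * z v) : ENNReal.ofReal |μ| ≤ alphaSpectralRadius α G := by
  classical
  have : μ ∈ spectrum ℝ (alphaMatrix α G) := by
    rw [← Matrix.spectrum_toLin', ← Module.End.hasEigenvalue_iff_mem_spectrum]
    refine Module.End.hasEigenvalue_of_hasEigenvector (x := z)
      (Module.End.hasEigenvector_iff.2 ⟨Module.End.mem_eigenspace_iff.2 ?_, hz⟩)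
    rw [Matrix.toLin'_apply, alphaMatrix_mulVec]
    ext v
    exact hμ v
  rw [← Real.norm_eq_abs, ofReal_norm]
  exact le_iSup₂_of_le (f := fun k (_ : k ∈ spectrum ℝ (alphaMatrix α G)) ↦ (‖k‖₊ : ℝ≥0∞))
    μ this le_rfl

/-- `A_α(G)` has a positive eigenvector if `G` is connected. -/
theorem exists_perron [Nonempty V] (h0 : 0 ≤ α) (h1 : α < 1) (hG : G.Connected) :
    ∃ (r : ℝ) (x : V → ℝ), (∀ v, 0 < x v) ∧ ∀ v, edgeSum α G x v = r * x v := by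
  classical
  set q : (V → ℝ) → ℝ := fun x ↦ x ⬝ᵥ (alphaMatrix α G).mulVec x with hq
  let S : Set (V → ℝ) := {x | (∀ v, 0 ≤ x v) ∧ x ⬝ᵥ x = 1}
  have hS : IsCompact S := by
    refine (isCompact_univ_pi fun _ : V ↦ isCompact_Icc (a := (0 : ℝ)) (b := 1)).of_isClosed_subset
      ?_ ?_
    · refine IsClosed.inter ?_ ?_
      · exact isClosed_Ici (a := (0 : V → ℝ))
      · exact isClosed_eq (by unfold dotProduct; fun_prop) continuous_const
    · rintro x ⟨hx, h⟩ v -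
      refine ⟨hx v, ?_⟩
      have : x v * x v ≤ x ⬝ᵥ x :=
        Finset.single_le_sum (f := fun w ↦ x w * x w) (fun w _ ↦ mul_self_nonneg _)
          (Finset.mem_univ v)
      nlinarith [hx v]
  have hSn : S.Nonempty := by
    obtain ⟨v⟩ := ‹Nonempty V›
    exact ⟨Pi.single v 1, fun w ↦ by by_cases h : w = v <;> simp [h], by simp⟩
  obtain ⟨x, ⟨hx, hxx⟩, hmax⟩ := hS.exists_isMaxOn hSn (f := q)
    (by simp only [hq]; unfold dotProduct Matrix.mulVec dotProduct; fun_prop)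
  set r := q x
  -- `x` maximizes the quadratic form only over nonnegative unit vectors, but replacing `z` by `|z|`
  -- does not decrease the form, so `r - A_α` is positive semidefinite. Its form vanishes at `x`,
  -- hence `x` lies in its kernel.
  have hpsd : (r • (1 : Matrix V V ℝ) - alphaMatrix α G).PosSemidef := by
    refine .of_dotProduct_mulVec_nonneg ?_ fun z ↦ ?_
    · rw [Matrix.IsHermitian, Matrix.conjTranspose_eq_transpose_of_trivial]
      simp [alphaMatrix_transpose]
    · simp only [star_trivial, Matrix.sub_mulVec, Matrix.smul_mulVec, Matrix.one_mulVec,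
        dotProduct_sub, dotProduct_smul, smul_eq_mul, sub_nonneg]
      rcases eq_or_ne z 0 with rfl | hz
      · simp
      set N := z ⬝ᵥ z
      have hN : 0 < N := by
        obtain ⟨v, hv⟩ := Function.ne_iff.1 hz
        exact Finset.sum_pos' (fun w _ ↦ mul_self_nonneg _)
          ⟨v, Finset.mem_univ _, mul_self_pos.2 hv⟩
      set y : V → ℝ := fun v ↦ |z v| with hy
      have h2 : z ⬝ᵥ (alphaMatrix α G).mulVec z ≤ y ⬝ᵥ (alphaMatrix α G).mulVec y := by
        rw [alphaMatrix_mulVec, alphaMatrix_mulVec]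
        refine Finset.sum_le_sum fun v _ ↦ (le_abs_self _).trans ?_
        rw [abs_mul]
        exact mul_le_mul_of_nonneg_left (abs_edgeSum_le h0 h1 z v) (abs_nonneg _)
      have hyy : y ⬝ᵥ y = N := by
        simp [hy, N, dotProduct]
      have hmem : (Real.sqrt N)⁻¹ • y ∈ S := by
        refine ⟨fun v ↦ mul_nonneg (by positivity) (abs_nonneg _), ?_⟩
        rw [smul_dotProduct, dotProduct_smul, hyy, smul_eq_mul, smul_eq_mul, ← mul_assoc,
          ← mul_inv, Real.mul_self_sqrt hN.le, inv_mul_cancel₀ hN.ne']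
      have h3 : q ((Real.sqrt N)⁻¹ • y) ≤ r := hmax hmem
      simp only [hq] at h3
      rw [Matrix.mulVec_smul, smul_dotProduct, dotProduct_smul, smul_eq_mul, smul_eq_mul,
        ← mul_assoc, ← mul_inv, Real.mul_self_sqrt hN.le, inv_mul_le_iff₀ hN] at h3
      linarith
  have hker : (r • (1 : Matrix V V ℝ) - alphaMatrix α G).mulVec x = 0 := by
    rw [← hpsd.dotProduct_mulVec_zero_iff]
    simp only [star_trivial, Matrix.sub_mulVec, Matrix.smul_mulVec, Matrix.one_mulVec,
        dotProduct_sub, dotProduct_smul, smul_eq_mul, hxx]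
    simp [r, hq]
  have hr : ∀ v, edgeSum α G x v = r * x v := fun v ↦ by
    have := congrFun hker v
    simp only [Matrix.sub_mulVec, Matrix.smul_mulVec, Matrix.one_mulVec, alphaMatrix_mulVec,
      Pi.sub_apply, Pi.smul_apply, smul_eq_mul, Pi.zero_apply] at this
    linarith
  refine ⟨r, x, fun v ↦ (hx v).lt_of_ne fun h ↦ ?_, hr⟩
  have h' := eq_zero_of_connected h0 h1 hG hx hr h.symm
  have : x = 0 := funext h'
  simp [this] at hxx

theorem alphaSpectralRadius_eq_of_pos_eigenvector [Nonempty V] (h0 : 0 ≤ α) (h1 : α < 1)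
    {x : V → ℝ} (hx : ∀ v, 0 < x v) {r : ℝ} (hr : ∀ v, edgeSum α G x v = r * x v) :
    alphaSpectralRadius α G = ENNReal.ofReal r := by
  classical
  have hx0 : x ≠ 0 := fun h ↦ by
    obtain ⟨v⟩ := ‹Nonempty V›
    simpa [h] using hx v
  have hr0 : 0 ≤ r := (abs_nonneg r).trans
    (abs_eigenvalue_le_of_supersolution h0 h1 hx (fun v ↦ (hr v).le) hx0 hr).1
  apply le_antisymm
  · refine iSup₂_le fun μ hμ ↦ ?_
    obtain ⟨z, hz, hzμ⟩ := exists_eigenvector_of_mem_spectrum hμ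
    have := (abs_eigenvalue_le_of_supersolution h0 h1 hx (fun v ↦ (hr v).le) hz hzμ).1
    change ‖μ‖ₑ ≤ _
    rw [← ofReal_norm]
    exact ENNReal.ofReal_le_ofReal this
  · simpa [abs_of_nonneg hr0] using ofReal_abs_le_alphaSpectralRadius hx0 hr

/-- If `A_α(G) x ≤ r x` for a positive vector `x`, with strict inequality in some coordinate, and
`G` is connected, then the `α`-spectral radius of `G` is less than `r`. -/
theorem alphaSpectralRadius_lt_of_supersolution (h0 : 0 ≤ α) (h1 : α < 1)
    (hG : G.Connected) {x : V → ℝ} (hx : ∀ v, 0 < x v) {r : ℝ}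
    (hr : ∀ v, edgeSum α G x v ≤ r * x v) {v₀ : V} (hv₀ : edgeSum α G x v₀ < r * x v₀) :
    alphaSpectralRadius α G < ENNReal.ofReal r := by
  have : Nonempty V := ⟨v₀⟩
  obtain ⟨μ, z, hz, hμ⟩ := exists_perron (α := α) h0 h1 hG
  have hz0 : z ≠ 0 := fun h ↦ by simpa [h] using hz v₀
  obtain ⟨hle, heq⟩ := abs_eigenvalue_le_of_supersolution h0 h1 hx hr hz0 hμ
  -- Equality would force the Perron vector to vanish at `v₀`.
  have hne : |μ| ≠ r := fun h ↦ (hz v₀).ne' (((heq h) v₀).2 hv₀)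
  have hlt := lt_of_le_of_ne hle hne
  rw [alphaSpectralRadius_eq_of_pos_eigenvector h0 h1 hz hμ]
  exact (ENNReal.ofReal_lt_ofReal_iff ((abs_nonneg μ).trans_lt hlt)).2
    ((le_abs_self μ).trans_lt hlt)

theorem edgeSum_comp_iso {W : Type*} [Fintype W] {H : SimpleGraph W} (e : G ≃g H) (x : W → ℝ)
    (v : V) : edgeSum α G (x ∘ e) v = edgeSum α H x (e v) := by
  classical
  refine Fintype.sum_equiv e.toEquiv _ _ fun w ↦ ?_
  have : G.Adj v w ↔ H.Adj (e v) (e w) := e.map_adj_iff.symm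
  simp only [RelIso.coe_fn_toEquiv, this, Function.comp_apply]

theorem alphaSpectralRadius_le_of_iso {W : Type*} [Fintype W] {H : SimpleGraph W} (e : G ≃g H) :
    alphaSpectralRadius α H ≤ alphaSpectralRadius α G := by
  classical
  refine iSup₂_le fun μ hμ ↦ ?_
  obtain ⟨z, hz, hzμ⟩ := exists_eigenvector_of_mem_spectrum hμ
  change ‖μ‖ₑ ≤ _
  rw [← ofReal_norm]
  refine ofReal_abs_le_alphaSpectralRadius (z := z ∘ e) (fun h ↦ hz ?_)
    fun v ↦ (edgeSum_comp_iso e z v).trans (hzμ _)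
  ext w
  have := congrFun h (e.symm w)
  simpa using this

theorem alphaSpectralRadius_eq_of_iso {W : Type*} [Fintype W] {H : SimpleGraph W} (e : G ≃g H) :
    alphaSpectralRadius α G = alphaSpectralRadius α H :=
  le_antisymm (alphaSpectralRadius_le_of_iso e.symm) (alphaSpectralRadius_le_of_iso e)

end Spectral

/-! ### Weights of pendant paths -/

/-- The weight that a pendant path of length `k` contributes to the diagonal entry of its root in
the equation `A_α x = r x` once the coordinates of its vertices are eliminated. -/
noncomputable def pathWeight (α r : ℝ) : ℕ → ℝ
  | 0 => 0
  | k + 1 => α + (1 - α) ^ 2 / (r - α - pathWeight α r k)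

/-- The solution of `A_α x = r x` along a pendant path of length `l` whose root has the value `y`,
as a function of the distance from the root. -/
noncomputable def pathSolution (α r y : ℝ) (l : ℕ) : ℕ → ℝ
  | 0 => y
  | k + 1 => (1 - α) * pathSolution α r y l k / (r - α - pathWeight α r (l - (k + 1)))

section PathWeight

variable {α r : ℝ}

/-- The bound 1 reproduces itself because `r > 2`: it gives `r - α - f_k > 1 - α`, so the fraction
in the recursion is below `1 - α`. The same bound keeps all later denominators positive. -/
theorem pathWeight_nonneg_lt_one (h0 : 0 ≤ α) (h1 : α < 1) (hr : 2 < r) (k : ℕ) :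
    0 ≤ pathWeight α r k ∧ pathWeight α r k < 1 := by
  induction k with
  | zero => simp [pathWeight]
  | succ k ih =>
    have hd : 1 - α < r - α - pathWeight α r k := by linarith
    rw [pathWeight]
    constructor
    · exact add_nonneg h0 (div_nonneg (sq_nonneg _) (by linarith))
    · have : (1 - α) ^ 2 / (r - α - pathWeight α r k) < 1 - α := by
        rw [div_lt_iff₀ (by linarith), pow_two]
        exact mul_lt_mul_of_pos_left hd (by linarith)
      linarith

theorem lt_sub_pathWeight (h0 : 0 ≤ α) (h1 : α < 1) (hr : 2 < r) (k : ℕ) :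
    1 - α < r - α - pathWeight α r k := by
  linarith [pathWeight_nonneg_lt_one h0 h1 hr k]

theorem pathWeight_strictMono (h0 : 0 ≤ α) (h1 : α < 1) (hr : 2 < r) :
    StrictMono (pathWeight α r) := by
  refine strictMono_nat_of_lt_succ fun k ↦ ?_
  have hc : 0 < (1 - α) ^ 2 := pow_pos (by linarith) 2
  induction k with
  | zero =>
    have := lt_sub_pathWeight h0 h1 hr 0
    have : 0 < (1 - α) ^ 2 / (r - α - pathWeight α r 0) := div_pos hc (by linarith)
    rw [pathWeight, pathWeight]
    linarith
  | succ k ih =>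
    have := lt_sub_pathWeight h0 h1 hr (k + 1)
    have : (1 - α) ^ 2 / (r - α - pathWeight α r k) <
        (1 - α) ^ 2 / (r - α - pathWeight α r (k + 1)) :=
      div_lt_div_of_pos_left hc (by linarith) (by linarith)
    rw [pathWeight, pathWeight]
    linarith

theorem pathSolution_pos (h0 : 0 ≤ α) (h1 : α < 1) (hr : 2 < r) {y : ℝ} (hy : 0 < y) (l k : ℕ) :
    0 < pathSolution α r y l k := by
  induction k with
  | zero => exact hy
  | succ k ih =>
    have := lt_sub_pathWeight h0 h1 hr (l - (k + 1))
    exact div_pos (mul_pos (by linarith) ih) (by linarith)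

end PathWeight

/-! ### Elimination of pendant edges and pendant paths -/

section Attach

variable {V : Type*} {α r : ℝ} {G : SimpleGraph V} {v : V} {s l : ℕ}

/-- The values of `x` along the path attached to `v`, as a function of the distance from `v`. -/
noncomputable def pathValues (v : V) (x : V ⊕ Fin l → ℝ) : ℕ → ℝ
  | 0 => x (.inl v)
  | k + 1 => if h : k < l then x (.inr ⟨k, h⟩) else 0

theorem pathValues_succ (x : V ⊕ Fin l → ℝ) (i : Fin l) :
    pathValues v x (i + 1) = x (.inr i) := by
  simp [pathValues]

/-- Extension of a vector to pendant vertices. -/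
noncomputable def extendPendants (α r : ℝ) (v : V) (s : ℕ) (x : V → ℝ) : V ⊕ Fin s → ℝ :=
  Sum.elim x fun _ ↦ pathSolution α r (x v) 1 1

/-- Extension of a vector to a pendant path. -/
noncomputable def extendPath (α r : ℝ) (v : V) (l : ℕ) (x : V → ℝ) : V ⊕ Fin l → ℝ :=
  Sum.elim x fun i ↦ pathSolution α r (x v) l (i + 1)

theorem extendPendants_pos (h0 : 0 ≤ α) (h1 : α < 1) (hr : 2 < r) {x : V → ℝ} (hx : ∀ v, 0 < x v)
    (w : V ⊕ Fin s) : 0 < extendPendants α r v s x w := by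
  rcases w with w | i
  · exact hx w
  · exact pathSolution_pos h0 h1 hr (hx v) _ _

theorem extendPath_pos (h0 : 0 ≤ α) (h1 : α < 1) (hr : 2 < r) {x : V → ℝ} (hx : ∀ v, 0 < x v)
    (w : V ⊕ Fin l) : 0 < extendPath α r v l x w := by
  rcases w with w | i
  · exact hx w
  · exact pathSolution_pos h0 h1 hr (hx v) _ _

variable [Fintype V]

theorem edgeSum_attachPendants_inl (x : V ⊕ Fin s → ℝ) (y : V) [Decidable (y = v)] :
    edgeSum α (attachPendants G v s) x (.inl y) = edgeSum α G (x ∘ .inl) y +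
      if y = v then ∑ i, (α * x (.inl v) + (1 - α) * x (.inr i)) else 0 := by
  classical
  rw [edgeSum, Fintype.sum_sum_type]
  congr 1
  split_ifs with h
  · subst h
    exact Finset.sum_congr rfl fun i _ ↦ if_pos rfl
  · exact Finset.sum_eq_zero fun i _ ↦ if_neg h

theorem edgeSum_attachPendants_inr (x : V ⊕ Fin s → ℝ) (i : Fin s) :
    edgeSum α (attachPendants G v s) x (.inr i) = α * x (.inr i) + (1 - α) * x (.inl v) := by
  classical
  have h1 : ∀ y, (attachPendants G v s).Adj (.inr i) (.inl y) ↔ y = v := fun y ↦ Iff.rfl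
  have h2 : ∀ j, (attachPendants G v s).Adj (.inr i) (.inr j) ↔ False := fun y ↦ Iff.rfl
  simp [edgeSum, Fintype.sum_sum_type, h1, h2]

theorem edgeSum_attachPath_inl (x : V ⊕ Fin l → ℝ) (y : V) [Decidable (y = v)] :
    edgeSum α (attachPath G v l) x (.inl y) = edgeSum α G (x ∘ .inl) y +
      if y = v then
        if 0 < l then α * pathValues v x 0 + (1 - α) * pathValues v x 1 else 0
      else 0 := by
  classical
  rw [edgeSum, Fintype.sum_sum_type]
  have h1 : ∀ j : Fin l, (attachPath G v l).Adj (.inl y) (.inr j) ↔ y = v ∧ (j : ℕ) = 0 :=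
    fun y ↦ Iff.rfl
  congr 1
  split_ifs with h hl
  · subst h
    rw [Finset.sum_eq_single (⟨0, hl⟩ : Fin l)]
    · simp [h1, pathValues, hl]
    · intro j _ hj
      exact if_neg fun h ↦ hj (Fin.ext h.2)
    · simp
  · exact Finset.sum_eq_zero fun i _ ↦ absurd (i.2.trans_le' (Nat.zero_le _)) hl
  · exact Finset.sum_eq_zero fun i _ ↦ if_neg fun h' ↦ h h'.1

/-- The terms are the edges towards and away from the root. The second edge is missing at the free
end, so the value 0 of `pathValues` beyond the path never enters. -/
theorem edgeSum_attachPath_inr (x : V ⊕ Fin l → ℝ) (i : Fin l) :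
    edgeSum α (attachPath G v l) x (.inr i) =
      α * pathValues v x (i + 1) + (1 - α) * pathValues v x i +
      if (i : ℕ) + 1 < l then α * pathValues v x (i + 1) + (1 - α) * pathValues v x (i + 2)
      else 0 := by
  classical
  rw [edgeSum, Fintype.sum_sum_type]
  have h1 : ∀ y, (attachPath G v l).Adj (.inr i) (.inl y) ↔ y = v ∧ (i : ℕ) = 0 := fun y ↦ Iff.rfl
  have h2 : ∀ j : Fin l, (attachPath G v l).Adj (.inr i) (.inr j) ↔
    ((i : ℕ) + 1 = j ∨ (j : ℕ) + 1 = i) := fun y ↦ Iff.rfl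
  simp only [h1, h2, ← pathValues_succ (v := v) x]
  -- The two alternatives exclude each other, so the sum splits into successor and predecessor.
  have hsplit : ∀ j : Fin l, (if (i : ℕ) + 1 = j ∨ (j : ℕ) + 1 = i then
      α * pathValues v x (i + 1) + (1 - α) * pathValues v x (j + 1) else 0) =
      (if (i : ℕ) + 1 = j then α * pathValues v x (i + 1) + (1 - α) * pathValues v x (j + 1)
        else 0) +
      (if (j : ℕ) + 1 = i then α * pathValues v x (i + 1) + (1 - α) * pathValues v x (j + 1)
        else 0) := by
    intro j
    by_cases h : (i : ℕ) + 1 = j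
    · have : ¬ (j : ℕ) + 1 = i := by omega
      simp [h, this]
    · simp [h]
  simp only [hsplit, Finset.sum_add_distrib]
  rw [← add_assoc, add_right_comm]
  congr 1
  -- The predecessor is the root `v` if `i = 0`, and a path vertex otherwise.
  · rcases Nat.eq_zero_or_pos (i : ℕ) with h | h
    · rw [Finset.sum_eq_single v, Finset.sum_eq_zero]
      · simp [h, pathValues]
      · intro j _
        exact if_neg (by omega)
      · intro w _ hw
        exact if_neg fun h ↦ hw h.1
      · simp
    · rw [Finset.sum_eq_zero, Finset.sum_eq_single (⟨i - 1, by omega⟩ : Fin l)]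
      · have : (i : ℕ) - 1 + 1 = i := by omega
        simp [this]
      · intro j _ hj
        exact if_neg fun h ↦ hj (Fin.ext (by simp; omega))
      · simp
      · intro w _
        exact if_neg fun h ↦ by omega
  · split_ifs with h
    · rw [Finset.sum_eq_single (⟨i + 1, h⟩ : Fin l)]
      · simp
      · intro j _ hj
        exact if_neg fun h ↦ hj (Fin.ext h.symm)
      · simp
    · exact Finset.sum_eq_zero fun j _ ↦ if_neg (by omega)

/-- Elimination of the pendant vertices from the equation `A_α x = r x`. -/
theorem edgeSum_attachPendants_of_eigen (hr : r - α ≠ 0) {x : V ⊕ Fin s → ℝ}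
    (hx : ∀ i, edgeSum α (attachPendants G v s) x (.inr i) = r * x (.inr i)) (y : V)
    [Decidable (y = v)] :
    edgeSum α (attachPendants G v s) x (.inl y) = edgeSum α G (x ∘ .inl) y +
      if y = v then s * pathWeight α r 1 * x (.inl y) else 0 := by
  rw [edgeSum_attachPendants_inl]
  congr 1
  split_ifs with h
  · subst h
    have : ∀ i, α * x (.inl y) + (1 - α) * x (.inr i) = pathWeight α r 1 * x (.inl y) := by
      intro i
      have := hx i
      rw [edgeSum_attachPendants_inr] at this
      have : x (.inr i) = (1 - α) * x (.inl y) / (r - α) := by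
        rw [eq_div_iff hr]
        linarith
      rw [this, pathWeight, pathWeight, sub_zero]
      ring
    simp [this, mul_assoc]
  · rfl

/-- Elimination of a pendant path from the equation `A_α x = r x`. -/
theorem edgeSum_attachPath_of_eigen (hr : ∀ k, r - α - pathWeight α r k ≠ 0)
    {x : V ⊕ Fin l → ℝ}
    (hx : ∀ i, edgeSum α (attachPath G v l) x (.inr i) = r * x (.inr i)) (y : V)
    [Decidable (y = v)] :
    edgeSum α (attachPath G v l) x (.inl y) = edgeSum α G (x ∘ .inl) y +
      if y = v then pathWeight α r l * x (.inl y) else 0 := by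
  rw [edgeSum_attachPath_inl]
  congr 1
  split_ifs with h hl
  · subst h
    -- `k` counts the path vertices beyond the one at distance `i + 1`; the induction runs from the
    -- free end to the root.
    have key : ∀ k, ∀ i : ℕ, i + k + 1 = l → (r - α - pathWeight α r k) * pathValues y x (i + 1) =
        (1 - α) * pathValues y x i := by
      intro k
      induction k with
      | zero =>
        intro i hi
        have := hx ⟨i, by omega⟩
        rw [edgeSum_attachPath_inr, ← pathValues_succ (v := y) x, if_neg (by simp; omega)] at this
        simp only [pathWeight] at this ⊢
        linarith
      | succ k ih =>
        intro i hi
        have := hx ⟨i, by omega⟩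
        rw [edgeSum_attachPath_inr, ← pathValues_succ (v := y) x, if_pos (by simp; omega)] at this
        have h2 : pathValues y x (i + 2) =
            (1 - α) * pathValues y x (i + 1) / (r - α - pathWeight α r k) := by
          rw [eq_div_iff (hr k), mul_comm, ih (i + 1) (by omega)]
        simp only [h2] at this
        rw [pathWeight]
        have h3 : (1 - α) ^ 2 / (r - α - pathWeight α r k) * pathValues y x (i + 1) =
          (1 - α) * ((1 - α) * pathValues y x (i + 1) / (r - α - pathWeight α r k)) := by ring
        linarith
    obtain ⟨m, rfl⟩ : ∃ m, l = m + 1 := ⟨l - 1, by omega⟩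
    have h1 : pathValues y x 1 = (1 - α) * pathValues y x 0 / (r - α - pathWeight α r m) := by
      rw [eq_div_iff (hr m), mul_comm, key m 0 (by omega)]
    rw [h1, pathWeight]
    change _ = _ * pathValues y x 0
    ring
  · obtain rfl : l = 0 := by omega
    simp [pathWeight]
  · rfl

theorem edgeSum_extendPendants_inr (hr : r - α ≠ 0) (x : V → ℝ) (i : Fin s) :
    edgeSum α (attachPendants G v s) (extendPendants α r v s x) (.inr i) =
      r * extendPendants α r v s x (.inr i) := by
  rw [edgeSum_attachPendants_inr]
  simp only [extendPendants, Sum.elim_inl, Sum.elim_inr, pathSolution, pathWeight, Nat.sub_self,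
    zero_add, sub_zero]
  field_simp
  ring

theorem edgeSum_extendPath_inr (hr : ∀ k, r - α - pathWeight α r k ≠ 0) (x : V → ℝ) (i : Fin l) :
    edgeSum α (attachPath G v l) (extendPath α r v l x) (.inr i) =
      r * extendPath α r v l x (.inr i) := by
  have hp : ∀ k ≤ l, pathValues v (extendPath α r v l x) k = pathSolution α r (x v) l k := by
    rintro (_ | k) hk
    · rfl
    · have : k < l := hk
      simp [pathValues, this, extendPath]
  rw [edgeSum_attachPath_inr, ← pathValues_succ (v := v) (extendPath α r v l x) i, hp _ i.2,
    hp _ i.2.le]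
  have h1 : (1 - α) * pathSolution α r (x v) l i =
      (r - α - pathWeight α r (l - (i + 1))) * pathSolution α r (x v) l (i + 1) := by
    rw [pathSolution, mul_div_cancel₀ _ (hr _)]
  rw [h1]
  split_ifs with h
  · rw [hp _ h]
    have h2 : l - (i + 1) = (l - (i + 2)) + 1 := by omega
    rw [h2, pathWeight, pathSolution.eq_2 α r (x v) l (i + 1)]
    simp only [add_assoc, one_add_one_eq_two]
    ring
  · have h2 : l - (i + 1) = 0 := by omega
    rw [h2, pathWeight]
    ring

end Attach

/-! ### Reduction of `thetaGraph` to the four vertices of `diamond` -/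

section Theta

variable {α r : ℝ} {u v : Fin 4} {s a b : ℕ}

/-- Elimination of the attached vertices from the equation `A_α x = r x` on a graph
`thetaGraph u v s a b`. -/
theorem edgeSum_thetaGraph_of_eigen (hr : ∀ k, r - α - pathWeight α r k ≠ 0)
    {x : ThetaVertex s a b → ℝ}
    (hs : ∀ i, edgeSum α (thetaGraph u v s a b) x (.inl (.inl (.inr i))) =
      r * x (.inl (.inl (.inr i))))
    (ha : ∀ i, edgeSum α (thetaGraph u v s a b) x (.inl (.inr i)) = r * x (.inl (.inr i)))
    (hb : ∀ i, edgeSum α (thetaGraph u v s a b) x (.inr i) = r * x (.inr i)) (z : Fin 4) :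
    edgeSum α (thetaGraph u v s a b) x (.inl (.inl (.inl z))) =
      edgeSum α diamond (fun w ↦ x (.inl (.inl (.inl w)))) z +
      (if z = u then (s * pathWeight α r 1 + pathWeight α r a) * x (.inl (.inl (.inl z))) else 0) +
      (if z = v then pathWeight α r b * x (.inl (.inl (.inl z))) else 0) := by
  classical
  have hr0 : r - α ≠ 0 := by simpa [pathWeight] using hr 0
  have eb := edgeSum_attachPath_of_eigen hr hb
  have ea := edgeSum_attachPath_of_eigen (x := x ∘ .inl)
    (G := attachPendants diamond u s) (v := .inl u) (l := a) hr fun i ↦ by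
      have := ha i
      rw [thetaGraph, eb, if_neg (by simp), add_zero] at this
      exact this
  have es := edgeSum_attachPendants_of_eigen (x := x ∘ .inl ∘ .inl) (G := diamond) (v := u)
    hr0 fun i ↦ by
      have := hs i
      rw [thetaGraph, eb, ea, if_neg (by simp), if_neg (by simp), add_zero, add_zero] at this
      exact this
  rw [thetaGraph, eb, ea]
  change edgeSum α (attachPendants diamond u s) (x ∘ .inl ∘ .inl) (.inl z) + _ + _ = _
  rw [es]
  simp only [Sum.inl.injEq, Function.comp_apply]
  change edgeSum α diamond (fun w ↦ x (.inl (.inl (.inl w)))) z + _ + _ + _ = _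
  by_cases h : z = u
  · simp only [h, if_true]
    ring
  · simp [h]

/-- Extension of a vector on `diamond` to the graphs `thetaGraph u v s a b`. -/
noncomputable def extendTheta (α r : ℝ) (u v : Fin 4) (s a b : ℕ) (y : Fin 4 → ℝ) :
    ThetaVertex s a b → ℝ :=
  extendPath α r (.inl (.inl v)) b (extendPath α r (.inl u) a (extendPendants α r u s y))

/-- A positive vector on `diamond` that satisfies `A_α y ≤ r y` with the weights of the attached
vertices on the diagonal bounds the `α`-spectral radius of `thetaGraph u v s a b`. -/
theorem alphaSpectralRadius_thetaGraph_lt (h0 : 0 ≤ α) (h1 : α < 1) (hr : 2 < r)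
    (hc : (thetaGraph u v s a b).Connected) {y : Fin 4 → ℝ} (hy : ∀ z, 0 < y z)
    (hle : ∀ z, edgeSum α diamond y z +
      (if z = u then (s * pathWeight α r 1 + pathWeight α r a) * y z else 0) +
      (if z = v then pathWeight α r b * y z else 0) ≤ r * y z) {z₀ : Fin 4}
    (hlt : edgeSum α diamond y z₀ +
      (if z₀ = u then (s * pathWeight α r 1 + pathWeight α r a) * y z₀ else 0) +
      (if z₀ = v then pathWeight α r b * y z₀ else 0) < r * y z₀) :
    alphaSpectralRadius α (thetaGraph u v s a b) < ENNReal.ofReal r := by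
  classical
  have hr' : ∀ k, r - α - pathWeight α r k ≠ 0 := fun k ↦ by
    have := lt_sub_pathWeight h0 h1 hr k
    linarith
  have hr0 : r - α ≠ 0 := by simpa [pathWeight] using hr' 0
  -- This extension solves the equation exactly at every attached vertex, so only the four
  -- inequalities on `diamond` remain.
  set x := extendTheta α r u v s a b y with hx
  have hb : ∀ i, edgeSum α (thetaGraph u v s a b) x (.inr i) = r * x (.inr i) :=
    edgeSum_extendPath_inr hr' _
  have eb := edgeSum_attachPath_of_eigen hr' hb
  have ha : ∀ i, edgeSum α (thetaGraph u v s a b) x (.inl (.inr i)) = r * x (.inl (.inr i)) := by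
    intro i
    rw [thetaGraph, eb, if_neg (by simp), add_zero]
    exact edgeSum_extendPath_inr hr' _ i
  have ea := edgeSum_attachPath_of_eigen (x := x ∘ .inl)
    (G := attachPendants diamond u s) (v := .inl u) (l := a) hr' (edgeSum_extendPath_inr hr' _)
  have hs : ∀ i, edgeSum α (thetaGraph u v s a b) x (.inl (.inl (.inr i))) =
      r * x (.inl (.inl (.inr i))) := by
    intro i
    rw [thetaGraph, eb, if_neg (by simp), add_zero, ea, if_neg (by simp), add_zero]
    exact edgeSum_extendPendants_inr hr0 _ i
  have hcore := edgeSum_thetaGraph_of_eigen hr' hs ha hb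
  have hxy : ∀ z, x (.inl (.inl (.inl z))) = y z := fun z ↦ rfl
  simp only [hxy] at hcore
  refine alphaSpectralRadius_lt_of_supersolution h0 h1 hc
    (extendPath_pos h0 h1 hr (extendPath_pos h0 h1 hr (extendPendants_pos h0 h1 hr hy)))
    (x := x) (v₀ := .inl (.inl (.inl z₀))) ?_ ?_
  · rintro (((z | i) | i) | i)
    · rw [hcore, hxy]
      exact hle z
    · exact (hs i).le
    · exact (ha i).le
    · exact (hb i).le
  · rw [hcore, hxy]
    exact hlt

theorem edgeSum_diamond (y : Fin 4 → ℝ) :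
    edgeSum α diamond y 0 = 2 * α * y 0 + (1 - α) * (y 1 + y 3) ∧
    edgeSum α diamond y 1 = 3 * α * y 1 + (1 - α) * (y 0 + y 2 + y 3) ∧
    edgeSum α diamond y 2 = 2 * α * y 2 + (1 - α) * (y 1 + y 3) ∧
    edgeSum α diamond y 3 = 3 * α * y 3 + (1 - α) * (y 0 + y 1 + y 2) := by
  classical
  simp only [edgeSum, diamond, Fin.sum_univ_four, SimpleGraph.deleteEdges_adj, SimpleGraph.top_adj,
    Set.mem_singleton_iff, Sym2.eq_iff]
  refine ⟨?_, ?_, ?_, ?_⟩ <;> simp <;> ring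

end Theta

/-! ### Real inequalities behind the comparisons -/

section RealInequalities

/-- Trading weight between the two paths: one factor loses `δ` while the other gains `ε`. The trade
pays if `δ (Y + ε) < ε X`, and `X ≥ g / Y` together with `Y (Y + ε) < m₁ m₂` gives this. -/
theorem lt_sub_mul_add {X Y ε δ g m₁ m₂ : ℝ} (hX : 0 < X) (hY : 0 < Y) (hg : 0 < g)
    (hXY : g ≤ X * Y) (hε : 0 < ε) (h₁ : Y < m₁) (h₂ : Y + ε < m₂)
    (hδ : δ ≤ ε * (g / (m₁ * m₂))) : δ < X ∧ X * Y < (X - δ) * (Y + ε) := by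
  have hYε : 0 < Y + ε := by linarith
  have hm : Y * (Y + ε) < m₁ * m₂ := mul_lt_mul'' h₁ h₂ hY.le hYε.le
  have hq : g / (m₁ * m₂) < X / (Y + ε) := by
    rw [div_lt_div_iff₀ ((mul_pos hY hYε).trans hm) hYε]
    have h3 : g * (Y + ε) ≤ X * (Y * (Y + ε)) := by
      rw [← mul_assoc]
      exact mul_le_mul_of_nonneg_right hXY hYε.le
    exact h3.trans_lt (mul_lt_mul_of_pos_left hm hX)
  have hδ' : δ * (Y + ε) < ε * X := by
    have : δ < ε * (X / (Y + ε)) := hδ.trans_lt (mul_lt_mul_of_pos_left hq hε)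
    rwa [← mul_div_assoc, lt_div_iff₀ hYε] at this
  refine ⟨?_, by linarith [sub_mul X δ (Y + ε), mul_add X Y ε]⟩
  by_contra! h
  have h4 := mul_le_mul_of_nonneg_right h hYε.le
  have h5 := mul_pos hX hY
  linarith [mul_add X Y ε]

/-- Removing the weight `q` from the second factor outweighs the loss `g / (M - q) - g / M` in the
first. For `g = (1 - α)²`, `M = r - α`, `q = f_k` this loss is `f_{k+1} - f_1`. -/
theorem lt_sub_mul_of_add {X K M q g : ℝ} (hX : 0 < X) (hq : 0 < q) (hqK : q < K) (hKM : K < M)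
    (hg : 0 < g) (h : g ≤ X * (K - q)) :
    g / (M - q) - g / M < X ∧ X * (K - q) < (X - (g / (M - q) - g / M)) * K := by
  have hK : 0 < K := by linarith
  have h1 : (g / (M - q) - g / M) * K < X * q := by
    have hMq : 0 < M - q := by linarith
    have hM : 0 < M := by linarith
    have e : (g / (M - q) - g / M) * K = g * (q * K) / ((M - q) * M) := by
      field_simp
      ring
    rw [e, div_lt_iff₀ (mul_pos hMq hM)]
    have h2 : (K - q) * K < (M - q) * M := mul_lt_mul'' (by linarith) hKM (by linarith) hK.le
    calc g * (q * K) ≤ X * (K - q) * (q * K) :=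
          mul_le_mul_of_nonneg_right h (mul_pos hq hK).le
      _ = X * q * ((K - q) * K) := by ring
      _ < X * q * ((M - q) * M) := mul_lt_mul_of_pos_left h2 (mul_pos hX hq)
  refine ⟨lt_of_mul_lt_mul_right (h1.trans (mul_lt_mul_of_pos_left hqK hX)) hK.le, ?_⟩
  linarith [sub_mul X (g / (M - q) - g / M) K, mul_sub X K q]

/-- Passage from `Θ₂` to `Θ₁`: `h` is the reduced inequality with weight `P` at `w₂`, the conclusion
the one with the same weight at `w₁`. -/
theorem two_mul_sq_lt_of_sq_le {α K t P : ℝ} (h0 : 0 ≤ α) (h1 : α < 1) (ht : 0 < t)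
    (htK : t * (K + α + t) = 2 * (1 - α) ^ 2) (hP : 0 < P) (hPK : P < K)
    (h : (1 - α + t) ^ 2 ≤ (K - P) * K) :
    1 - α < K ∧ 2 * (1 - α) ^ 2 < (K + α + t - P) * (K - (1 - α)) := by
  have hc : 0 < 1 - α := by linarith
  have hK : 0 < K := by linarith
  have hKc : 1 - α + t < K := by
    refine lt_of_pow_lt_pow_left₀ 2 hK.le (h.trans_lt ?_)
    rw [pow_two]
    exact mul_lt_mul_of_pos_right (by linarith) hK
  refine ⟨by linarith, ?_⟩
  rw [← htK]
  have e1 : (1 - α + t) * t < (K - P) * (K - (1 - α)) := by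
    refine lt_of_mul_lt_mul_right ?_ hK.le
    -- The two sides differ by `(1 - α + t)` times `(1 - α) (K - (1 - α) - t)`.
    calc (1 - α + t) * t * K < (1 - α + t) * ((1 - α + t) * (K - (1 - α))) := by
          rw [mul_assoc]
          refine mul_lt_mul_of_pos_left ?_ (by linarith)
          nlinarith [mul_pos hc (sub_pos.2 hKc)]
      _ = (1 - α + t) ^ 2 * (K - (1 - α)) := by ring
      _ ≤ (K - P) * K * (K - (1 - α)) := mul_le_mul_of_nonneg_right h (by linarith)
      _ = _ := by ring
  nlinarith [mul_nonneg h0 (sub_pos.2 hKc).le]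

/-- The case `α + h < 1 - α` of the next lemma, once the products `t Z` and `h Z` are replaced by
polynomials in `α, t, h`. -/
theorem perturbation_pos_of_small_weight {α t h : ℝ} (h0 : 0 ≤ α) (ht : 0 < t)
    (hD : 0 < 1 - 2 * α - h) (h1 : t ≤ 3 * h) (h2 : 2 * h ≤ t)
    (hw : t * (1 + α + 2 * t + h) ≤ 2 * (1 - α) ^ 2) :
    0 < (1 - 2 * α - h) * ((1 - α) ^ 2 - 2 * t - 2 * t ^ 2 - t * h) +
      ((1 - α) ^ 2 - h * (3 * α + t + h)) * (1 + α + 2 * t) := by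
  nlinarith [mul_nonneg h0 ht.le, mul_pos ht hD, mul_nonneg h0 hD.le,
    mul_nonneg (sub_nonneg.2 hw) hD.le, mul_nonneg (sub_nonneg.2 hw) ht.le,
    mul_nonneg (sub_nonneg.2 hw) h0, mul_nonneg (sub_nonneg.2 h1) hD.le,
    mul_nonneg (sub_nonneg.2 h2) hD.le, mul_nonneg (sub_nonneg.2 h1) ht.le,
    mul_nonneg (sub_nonneg.2 h2) ht.le]

/-- Passage from `Θ₃` to `Θ₁`, for `h = (1 - α)² / (r - α)`, so that `α + h = f_1`: weights `P` at
`w₂` and `f_1` at `w₄` against `P + f_1` at `w₁`. The detour through `Θ₂` does not serve here, since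
moving these attachments from `w₁` to `w₂` decreases the diameter. -/
theorem two_mul_sq_lt_of_sq_le_pendant {α K t h P : ℝ} (h0 : 0 ≤ α) (h1 : α < 1) (ht : 0 < t)
    (htK : t * (K + α + t) = 2 * (1 - α) ^ 2) (hh : h * (K + 2 * α + t) = (1 - α) ^ 2)
    (hh0 : 0 < h) (hP : α + h ≤ P) (hPK : P < K)
    (hle : (1 - α + t) ^ 2 ≤ (K - P) * (K - (α + h))) :
    1 - α < K ∧ 2 * (1 - α) ^ 2 < (K + α + t - (P + (α + h))) * (K - (1 - α)) := by
  set Z := K - (α + h) with hZ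
  have hZ0 : 0 < Z := by linarith
  have hZc : 1 - α + t ≤ Z := by
    refine le_of_sq_le_sq ?_ hZ0.le
    rw [pow_two Z]
    exact hle.trans (mul_le_mul_of_nonneg_right (by linarith) hZ0.le)
  refine ⟨by linarith, ?_⟩
  have hK1 : 1 + t + h ≤ K := by linarith
  have hM : 0 < K + 2 * α + t := by linarith
  -- Both quantities are tied by `2 h (K + 2α + t) = t (K + α + t)`, which puts `t / h` between 2
  -- and 3.
  have h2 : 2 * h ≤ t := by
    refine le_of_mul_le_mul_right ?_ hM
    nlinarith [mul_nonneg ht.le h0]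
  have h3 : t ≤ 3 * h := by
    refine le_of_mul_le_mul_right ?_ hM
    nlinarith [mul_nonneg ht.le h0, mul_pos ht ht]
  have hXZ : (1 - α + t) ^ 2 * (K - (1 - α)) ≤ (K - P) * (K - (1 - α)) * Z := by
    have := mul_le_mul_of_nonneg_right hle (by linarith : 0 ≤ K - (1 - α))
    linarith
  -- The goal multiplied by `Z`, after `hXZ` has bounded the product containing `P` and the defining
  -- equations of `t` and `h` have removed their products with `K`.
  suffices hs : 0 < Z * (t * (1 - 2 * α) + h * (1 + α + t)) +
      (1 - α + t) ^ 2 * (α + h - (1 - α)) by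
    refine lt_of_mul_lt_mul_right ?_ hZ0.le
    have hKZ : K = Z + (α + h) := by linarith
    have e : (K + α + t - (P + (α + h))) * (K - (1 - α)) * Z =
        (K - P) * (K - (1 - α)) * Z + ((t - h) * (K - (1 - α))) * Z := by ring
    have e2 : (t - h) * (K - (1 - α)) =
        2 * (1 - α) ^ 2 - t * (1 + t) - ((1 - α) ^ 2 - h * (1 + α + t)) := by
      rw [← htK, ← hh]
      ring
    rw [e, e2]
    have e3 : K - (1 - α) = Z + (α + h - (1 - α)) := by linarith
    rw [e3] at hXZ
    rw [e3]
    linarith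
  -- The sign of the last summand decides. If it is nonnegative, `h Z ≤ (1 - α + t)²` makes `Z` a
  -- common factor; otherwise `t Z` and `h Z` are expanded.
  rcases le_or_gt (1 - α) (α + h) with hd | hd
  · have e1 : h * Z ≤ (1 - α + t) ^ 2 := by
      rw [hZ]
      linarith [mul_nonneg hh0.le h0, mul_pos hh0 ht, mul_pos hh0 hh0,
        mul_pos (sub_pos.2 h1) ht, mul_pos ht ht]
    have e2 : h * Z * (α + h - (1 - α)) ≤ (1 - α + t) ^ 2 * (α + h - (1 - α)) :=
      mul_le_mul_of_nonneg_right e1 (by linarith)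
    have e3 : 0 < t * (1 - 2 * α) + h * (1 + α + t) + h * (α + h - (1 - α)) := by
      have hk : t * (1 + α) ≤ 2 * h * (1 + 2 * α) := by
        refine le_of_mul_le_mul_right ?_ hM
        have e4 : 2 * h * (1 + 2 * α) * (K + 2 * α + t) = t * (K + α + t) * (1 + 2 * α) := by
          rw [htK, ← hh]
          ring
        rw [e4]
        linarith [mul_nonneg (mul_nonneg ht.le h0) (by linarith : 0 ≤ K - 1 + t)]
      have : 0 ≤ t * (1 - 2 * α) + 3 * α * h := by
        refine le_of_mul_le_mul_right (a := 2 * (1 + 2 * α)) ?_ (by linarith)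
        linarith [mul_nonneg (mul_nonneg ht.le (sub_pos.2 h1).le) h0,
          mul_nonneg ht.le (sub_pos.2 h1).le, mul_le_mul_of_nonneg_left hk h0]
      linarith [mul_pos hh0 ht, mul_pos hh0 hh0]
    linarith [mul_pos hZ0 e3]
  · have hD : 0 < 1 - 2 * α - h := by linarith
    have hw : t * (1 + α + 2 * t + h) ≤ 2 * (1 - α) ^ 2 := by
      rw [← htK]
      exact mul_le_mul_of_nonneg_left (by linarith) ht.le
    have := perturbation_pos_of_small_weight h0 ht hD h3 h2 hw
    have e1 : t * Z = 2 * (1 - α) ^ 2 - t ^ 2 - 2 * α * t - t * h := by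
      rw [← htK, hZ]
      ring
    have e2 : h * Z = (1 - α) ^ 2 - h * (3 * α + t + h) := by
      rw [← hh, hZ]
      ring
    calc _ < _ := this
      _ = (1 - 2 * α - h) * (t * Z - (1 - α + t) ^ 2) + h * Z * (1 + α + 2 * t) := by
        rw [e1, e2]
        ring
      _ = _ := by ring

end RealInequalities

/-! ### Contraction of path weights and balancing of two paths -/

section PathWeightInequalities

variable {α r : ℝ}

theorem pathWeight_one : pathWeight α r 1 = α + (1 - α) ^ 2 / (r - α) := by
  simp [pathWeight]

/-- The differences of the path weights decrease under shifts. -/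
theorem pathWeight_shift_sub_le (h0 : 0 ≤ α) (h1 : α < 1) (hr : 2 < r) {k l : ℕ} (hlk : l ≤ k)
    (n : ℕ) : pathWeight α r (k + n + 1) - pathWeight α r (l + n + 1) ≤
      (pathWeight α r k - pathWeight α r l) *
        ((1 - α) ^ 2 / ((r - α - pathWeight α r k) * (r - α - pathWeight α r l))) := by
  -- One step multiplies a difference of weights by an explicit factor. The first step keeps it; in
  -- later steps it is at most 1, both denominators exceeding `1 - α`.
  have hsucc : ∀ i j, pathWeight α r (i + 1) - pathWeight α r (j + 1) =
      (pathWeight α r i - pathWeight α r j) *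
        ((1 - α) ^ 2 / ((r - α - pathWeight α r i) * (r - α - pathWeight α r j))) := by
    intro i j
    have hi := lt_sub_pathWeight h0 h1 hr i
    have hj := lt_sub_pathWeight h0 h1 hr j
    have hi' : r - α - pathWeight α r i ≠ 0 := by linarith
    have hj' : r - α - pathWeight α r j ≠ 0 := by linarith
    rw [pathWeight, pathWeight]
    field_simp
    ring
  induction n with
  | zero => exact (hsucc k l).le
  | succ n ih =>
    refine le_trans ?_ ih
    have hi := lt_sub_pathWeight h0 h1 hr (k + n + 1)
    have hj := lt_sub_pathWeight h0 h1 hr (l + n + 1)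
    have hm := (pathWeight_strictMono h0 h1 hr).monotone (by omega : l + n + 1 ≤ k + n + 1)
    rw [← add_assoc, ← add_assoc, hsucc]
    refine mul_le_of_le_one_right (by linarith) ?_
    rw [div_le_one (mul_pos (by linarith) (by linarith)), pow_two]
    exact mul_le_mul hi.le hj.le (by linarith) (by linarith)

/-- Balancing the two pendant paths minimizes `(L - f_a) (K - f_b)`. -/
theorem lt_mul_of_unbalanced (h0 : 0 ≤ α) (h1 : α < 1) (hr : 2 < r) {K L : ℝ}
    (hK : K < r - α) (hL : L ≤ K) {a₀ b₀ a b : ℕ} (ha₀ : pathWeight α r a₀ < L)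
    (hb₀ : pathWeight α r b₀ < K)
    (hc : (1 - α) ^ 2 ≤ (L - pathWeight α r a₀) * (K - pathWeight α r b₀))
    (hab : a + b = a₀ + b₀) (hle : b₀ ≤ a₀) (hle' : a₀ ≤ b₀ + 1) (hne : a ≠ a₀)
    (hswap : a = b₀ → L < K) :
    pathWeight α r a < L ∧ (L - pathWeight α r a₀) * (K - pathWeight α r b₀) <
      (L - pathWeight α r a) * (K - pathWeight α r b) := by
  have hmono := pathWeight_strictMono h0 h1 hr
  have hc0 : 0 < (1 - α) ^ 2 := pow_pos (by linarith) 2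
  rcases lt_or_gt_of_ne hne with h | h
  · by_cases hab₀ : a = b₀
    · obtain rfl : b = a₀ := by omega
      subst hab₀
      have h2 := hmono h
      exact ⟨by linarith, by nlinarith [hswap rfl]⟩
    · obtain ⟨n, hn⟩ : ∃ n, b = a₀ + n + 1 := ⟨b - a₀ - 1, by omega⟩
      have h2 : b₀ = a + n + 1 := by omega
      -- The path at `K` grows from `b₀` to `b`, the one at `L` shrinks from `a₀` to `a`: the pair
      -- `(b, b₀)` is `(a₀, a)` shifted by `n + 1`.
      have h3 := pathWeight_shift_sub_le h0 h1 hr h.le n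
      rw [← h2, ← hn] at h3
      have h4 := hmono h
      have := lt_sub_mul_add (X := K - pathWeight α r b₀) (Y := L - pathWeight α r a₀)
        (by linarith) (by linarith) hc0 (by linarith) (by linarith) (by linarith) (by linarith) h3
      exact ⟨by linarith, by linarith⟩
  · obtain ⟨n, hn⟩ : ∃ n, a₀ = b + n + 1 := ⟨a₀ - b - 1, by omega⟩
    have hbb : b < b₀ := by omega
    have h4 := hmono hbb
    obtain ⟨m, hm⟩ : ∃ m, a = b₀ + m + 1 := ⟨a - b₀ - 1, by omega⟩
    have h3 := pathWeight_shift_sub_le h0 h1 hr hbb.le m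
    have h5 : b + m + 1 ≤ a₀ := by omega
    have h6 := hmono.monotone h5
    rw [← hm] at h3
    have := lt_sub_mul_add (X := L - pathWeight α r a₀) (Y := K - pathWeight α r b₀)
      (δ := pathWeight α r a - pathWeight α r a₀)
      (by linarith) (by linarith) hc0 (by linarith) (by linarith) (by linarith) (by linarith)
      (le_trans (by linarith) h3)
    exact ⟨by linarith, by linarith⟩

end PathWeightInequalities

/-! ### The reduced equation on `diamond` -/

section Core

variable {α r : ℝ}

/-- The coupling of the vertices of degree `3` of `diamond` through those of degree `2`. -/
noncomputable def coreShift (α r : ℝ) : ℝ := 2 * (1 - α) ^ 2 / (r - 2 * α)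

/-- The diagonal entry at the vertices of degree `3` of `diamond` in the reduced equation. -/
noncomputable def coreGap (α r : ℝ) : ℝ := r - 3 * α - coreShift α r

theorem coreShift_pos (h1 : α < 1) (hr : 2 < r) : 0 < coreShift α r :=
  div_pos (mul_pos two_pos (pow_pos (by linarith) 2)) (by linarith)

theorem coreShift_mul (h1 : α < 1) (hr : 2 < r) :
    coreShift α r * (coreGap α r + α + coreShift α r) = 2 * (1 - α) ^ 2 := by
  have : coreGap α r + α + coreShift α r = r - 2 * α := by
    rw [coreGap]
    ring
  rw [this, coreShift, div_mul_cancel₀]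
  linarith

theorem coreGap_lt (h0 : 0 ≤ α) (h1 : α < 1) (hr : 2 < r) : coreGap α r < r - α := by
  have := coreShift_pos h1 hr
  rw [coreGap]
  linarith

/-- Treats `Θ₂` (`v = 1`, hence `Q = 0`) and `Θ₃` (`v = 3`) together. The test vector solves the
equation at `w₁, w₂, w₃`; the hypothesis `h` is the strict inequality at `w₄`. -/
theorem alphaSpectralRadius_thetaGraph_one_lt (h0 : 0 ≤ α) (h1 : α < 1) (hr : 2 < r) {v : Fin 4}
    {s a b : ℕ} (hc : (thetaGraph 1 v s a b).Connected) {P Q : ℝ}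
    (hP : s * pathWeight α r 1 + pathWeight α r a + (if 1 = v then pathWeight α r b else 0) = P)
    (hQ : (if 3 = v then pathWeight α r b else 0) = Q) (hv : v = 1 ∨ v = 3)
    (hPK : P < coreGap α r)
    (h : (1 - α + coreShift α r) ^ 2 < (coreGap α r - P) * (coreGap α r - Q)) :
    alphaSpectralRadius α (thetaGraph 1 v s a b) < ENNReal.ofReal r := by
  have ht := coreShift_pos h1 hr
  have htr : coreShift α r * (r - 2 * α) = 2 * (1 - α) ^ 2 := by
    rw [coreShift, div_mul_cancel₀]
    linarith
  set t := coreShift α r with htdef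
  set K := coreGap α r with hK
  have hKr : K = r - 3 * α - t := rfl
  have hc0 : 0 < 1 - α := by linarith
  have hr0 : 0 < r - 2 * α := by linarith
  -- The value forced at `w₁` and `w₃` by the values at `w₂` and `w₄`, written without the
  -- denominator `r - 2α`.
  set w := t * (1 - α + t + (K - P)) / (2 * (1 - α)) with hw
  have hw' : 2 * (1 - α) * w = t * (1 - α + t + (K - P)) := by
    rw [hw]
    field_simp
  have hw2 : (r - 2 * α) * w = (1 - α) * (1 - α + t + (K - P)) := by
    refine mul_left_cancel₀ (by linarith : 2 * (1 - α) ≠ 0) ?_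
    rw [mul_left_comm, hw', ← mul_assoc, mul_comm (r - 2 * α), htr]
    ring
  have hwpos : 0 < w := div_pos (mul_pos ht (by linarith)) (by linarith)
  obtain ⟨d0, d1, d2, d3⟩ := edgeSum_diamond (α := α) ![w, 1 - α + t, w, K - P]
  have e0 : edgeSum α diamond ![w, 1 - α + t, w, K - P] 0 = r * w := by
    rw [d0]
    simp
    linarith
  have e2 : edgeSum α diamond ![w, 1 - α + t, w, K - P] 2 = r * w := by
    rw [d2]
    simp
    linarith
  have e1 : edgeSum α diamond ![w, 1 - α + t, w, K - P] 1 + P * (1 - α + t) =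
      r * (1 - α + t) := by
    rw [d1]
    simp
    linear_combination hw' + (1 - α + t) * hKr
  have e3 : edgeSum α diamond ![w, 1 - α + t, w, K - P] 3 + Q * (K - P) < r * (K - P) := by
    rw [d3]
    simp
    have : r = K + 3 * α + t := by linarith
    rw [this]
    linarith
  have hPQ : ∀ z, (if z = 1 then (s * pathWeight α r 1 + pathWeight α r a) *
        (![w, 1 - α + t, w, K - P] : Fin 4 → ℝ) z else 0) +
      (if z = v then pathWeight α r b * (![w, 1 - α + t, w, K - P] : Fin 4 → ℝ) z else 0) =
      (![0, P * (1 - α + t), 0, Q * (K - P)] : Fin 4 → ℝ) z := by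
    subst hP hQ
    intro z
    rcases hv with rfl | rfl <;> fin_cases z <;> simp [add_mul]
  refine alphaSpectralRadius_thetaGraph_lt h0 h1 hr hc (y := ![w, 1 - α + t, w, K - P])
    (z₀ := 3) ?_ ?_ ?_
  · intro z
    fin_cases z
    · exact hwpos
    · exact (by linarith : 0 < 1 - α + t)
    · exact hwpos
    · exact (by linarith : 0 < K - P)
  · intro z
    rw [add_assoc, hPQ]
    fin_cases z
    · exact ((add_zero _).trans e0).le
    · exact e1.le
    · exact ((add_zero _).trans e2).le
    · exact e3.le
  · rw [add_assoc, hPQ]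
    exact e3

theorem alphaSpectralRadius_theta₃_lt (h0 : 0 ≤ α) (h1 : α < 1) (hr : 2 < r) {s a b : ℕ}
    (hc : (theta₃ s a b).Connected)
    (hP : s * pathWeight α r 1 + pathWeight α r a < coreGap α r)
    (h : (1 - α + coreShift α r) ^ 2 < (coreGap α r - (s * pathWeight α r 1 + pathWeight α r a)) *
      (coreGap α r - pathWeight α r b)) :
    alphaSpectralRadius α (theta₃ s a b) < ENNReal.ofReal r :=
  alphaSpectralRadius_thetaGraph_one_lt h0 h1 hr hc (by simp) (by simp) (.inr rfl) hP h

theorem alphaSpectralRadius_theta₂_lt (h0 : 0 ≤ α) (h1 : α < 1) (hr : 2 < r) {s a b : ℕ}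
    (hc : (theta₂ s a b).Connected)
    (hP : s * pathWeight α r 1 + pathWeight α r a + pathWeight α r b < coreGap α r)
    (h : (1 - α + coreShift α r) ^ 2 <
      (coreGap α r - (s * pathWeight α r 1 + pathWeight α r a + pathWeight α r b)) *
        coreGap α r) :
    alphaSpectralRadius α (theta₂ s a b) < ENNReal.ofReal r :=
  alphaSpectralRadius_thetaGraph_one_lt h0 h1 hr hc (Q := 0) (by simp) (by simp) (.inl rfl) hP
    (by simpa using h)

theorem alphaSpectralRadius_theta₁_lt (h0 : 0 ≤ α) (h1 : α < 1) (hr : 2 < r) {s a b : ℕ}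
    (hc : (theta₁ s a b).Connected) {P : ℝ}
    (hP : s * pathWeight α r 1 + pathWeight α r a + pathWeight α r b = P)
    (hK : 1 - α < coreGap α r)
    (h : 2 * (1 - α) ^ 2 <
      (coreGap α r + α + coreShift α r - P) * (coreGap α r - (1 - α))) :
    alphaSpectralRadius α (theta₁ s a b) < ENNReal.ofReal r := by
  have ht := coreShift_pos h1 hr
  have htr : coreShift α r * (r - 2 * α) = 2 * (1 - α) ^ 2 := by
    rw [coreShift, div_mul_cancel₀]
    linarith
  set t := coreShift α r with htdef
  set K := coreGap α r
  have hKr : r = K + 3 * α + t := by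
    simp only [K, coreGap, ← htdef]
    ring
  -- Solves the equation at `w₂, w₃, w₄`; the hypothesis `h` is the strict inequality at `w₁`.
  set y : Fin 4 → ℝ := ![K - (1 - α), 1 - α, t, 1 - α] with hy
  have y0 : y 0 = K - (1 - α) := rfl
  have y1 : y 1 = 1 - α := rfl
  have y2 : y 2 = t := rfl
  have y3 : y 3 = 1 - α := rfl
  obtain ⟨d0, d1, d2, d3⟩ := edgeSum_diamond (α := α) y
  rw [y0, y1, y3] at d0
  rw [y0, y1, y2, y3] at d1 d3
  rw [y1, y2, y3] at d2
  have e0 : edgeSum α diamond y 0 + P * y 0 < r * y 0 := by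
    rw [d0, y0, hKr]
    linarith
  have hPs : ∀ z, (if z = 0 then (s * pathWeight α r 1 + pathWeight α r a) * y z else 0) +
      (if z = 0 then pathWeight α r b * y z else 0) = if z = 0 then P * y z else 0 := by
    intro z
    rw [← hP]
    split_ifs <;> ring
  refine alphaSpectralRadius_thetaGraph_lt h0 h1 hr hc (y := y) (z₀ := 0) ?_ ?_ ?_
  · intro z
    fin_cases z
    · exact sub_pos.2 hK
    · exact sub_pos.2 h1
    · exact ht
    · exact sub_pos.2 h1
  · intro z
    rw [add_assoc, hPs]
    fin_cases z
    · exact e0.le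
    · simp [d1, y1, hKr]
      linarith
    · change edgeSum α diamond y 2 + 0 ≤ r * y 2
      rw [d2, y2]
      linarith
    · simp [d3, y3, hKr]
      linarith
  · rw [add_assoc, hPs]
    exact e0

theorem edgeSum_comp_le {V W : Type*} [Fintype V] [Fintype W] {G : SimpleGraph V}
    {H : SimpleGraph W} (h0 : 0 ≤ α) (h1 : α < 1) {f : V → W} (hf : Function.Injective f)
    (hGH : ∀ v w, G.Adj v w → H.Adj (f v) (f w)) {x : W → ℝ} (hx : ∀ w, 0 ≤ x w) (v : V) :
    edgeSum α G (x ∘ f) v ≤ edgeSum α H x (f v) := by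
  classical
  have hnn : ∀ w, 0 ≤ if H.Adj (f v) w then α * x (f v) + (1 - α) * x w else 0 := fun w ↦ by
    split_ifs
    · exact add_nonneg (mul_nonneg h0 (hx _)) (mul_nonneg (by linarith) (hx _))
    · exact le_rfl
  calc edgeSum α G (x ∘ f) v
      ≤ ∑ w, if H.Adj (f v) (f w) then α * x (f v) + (1 - α) * x (f w) else 0 := by
        refine Finset.sum_le_sum fun w _ ↦ ?_
        by_cases h : G.Adj v w
        · rw [if_pos h, if_pos (hGH v w h)]
          rfl
        · rw [if_neg h]
          exact hnn _
    _ = ∑ w ∈ Finset.univ.map ⟨f, hf⟩,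
          if H.Adj (f v) w then α * x (f v) + (1 - α) * x w else 0 := by simp
    _ ≤ edgeSum α H x (f v) :=
        Finset.sum_le_sum_of_subset_of_nonneg (Finset.subset_univ _) fun w _ _ ↦ hnn w

/-- The equation of the Perron root of `theta₃ s a b`. -/
theorem exists_perron_theta₃ (h0 : 0 ≤ α) (h1 : α < 1) {s a b : ℕ}
    (hc : (theta₃ s a b).Connected) :
    ∃ r, 2 < r ∧ alphaSpectralRadius α (theta₃ s a b) = ENNReal.ofReal r ∧
      s * pathWeight α r 1 + pathWeight α r a < coreGap α r ∧
      pathWeight α r b < coreGap α r ∧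
      (coreGap α r - (s * pathWeight α r 1 + pathWeight α r a)) *
        (coreGap α r - pathWeight α r b) = (1 - α + coreShift α r) ^ 2 := by
  have : Nonempty (ThetaVertex s a b) := ⟨.inl (.inl (.inl 0))⟩
  obtain ⟨r, x, hx, hxr⟩ := exists_perron (α := α) h0 h1 hc
  set y : Fin 4 → ℝ := fun z ↦ x (.inl (.inl (.inl z))) with hy
  have hypos : ∀ z, 0 < y z := fun z ↦ hx _
  obtain ⟨d0, d1, d2, d3⟩ := edgeSum_diamond (α := α) y
  have hle : ∀ z, edgeSum α diamond y z ≤ r * y z := by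
    intro z
    rw [← hxr]
    exact edgeSum_comp_le h0 h1 (f := fun z : Fin 4 ↦ (.inl (.inl (.inl z)) : ThetaVertex s a b))
      (fun _ _ h ↦ by simpa using h) (fun _ _ h ↦ h) (fun w ↦ (hx w).le) z
  -- Summing over `diamond` weights each entry of `y` by its degree, 2 or 3, and the entries at
  -- degree 3 are positive.
  have hr : 2 < r := by
    have hsum : 0 < y 0 + y 1 + y 2 + y 3 := by
      linarith [hypos 0, hypos 1, hypos 2, hypos 3]
    refine lt_of_mul_lt_mul_right ?_ hsum.le
    linarith [hle 0, hle 1, hle 2, hle 3, hypos 1, hypos 3]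
  have hr' : ∀ k, r - α - pathWeight α r k ≠ 0 := fun k ↦ by
    have := lt_sub_pathWeight h0 h1 hr k
    linarith
  have hcore := edgeSum_thetaGraph_of_eigen (u := 1) (v := 3) (x := x) hr' (fun _ ↦ hxr _)
    (fun _ ↦ hxr _) (fun _ ↦ hxr _)
  have hyz : ∀ z, x (.inl (.inl (.inl z))) = y z := fun _ ↦ rfl
  have hxr' : ∀ z, edgeSum α (thetaGraph 1 3 s a b) x (.inl (.inl (.inl z))) = r * y z :=
    fun z ↦ hxr _
  simp only [hyz, hxr'] at hcore
  have c0 := hcore 0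
  have c1 := hcore 1
  have c2 := hcore 2
  have c3 := hcore 3
  change r * y 0 = edgeSum α diamond y 0 + _ + _ at c0
  change r * y 1 = edgeSum α diamond y 1 + _ + _ at c1
  change r * y 2 = edgeSum α diamond y 2 + _ + _ at c2
  change r * y 3 = edgeSum α diamond y 3 + _ + _ at c3
  rw [d0] at c0
  rw [d1] at c1
  rw [d2] at c2
  rw [d3] at c3
  simp at c0 c1 c2 c3
  have htr : coreShift α r * (r - 2 * α) = 2 * (1 - α) ^ 2 := by
    rw [coreShift, div_mul_cancel₀]
    linarith
  have ht := coreShift_pos h1 hr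
  set P := s * pathWeight α r 1 + pathWeight α r a
  set Q := pathWeight α r b
  have hK : coreGap α r = r - 3 * α - coreShift α r := rfl
  set t := coreShift α r
  set K := coreGap α r
  have hr0 : r - 2 * α ≠ 0 := by linarith
  have h02 : (1 - α) * (y 0 + y 2) = t * (y 1 + y 3) := by
    refine mul_left_cancel₀ hr0 ?_
    linear_combination (1 - α) * c0 + (1 - α) * c2 - (y 1 + y 3) * htr
  have f1 : (K - P) * y 1 = (1 - α + t) * y 3 := by
    rw [hK]
    linear_combination c1 + h02
  have f3 : (K - Q) * y 3 = (1 - α + t) * y 1 := by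
    rw [hK]
    linear_combination c3 + h02
  have hct : 0 < 1 - α + t := by linarith
  refine ⟨r, hr, alphaSpectralRadius_eq_of_pos_eigenvector h0 h1 hx hxr, ?_, ?_, ?_⟩
  · have := pos_of_mul_pos_left (f1 ▸ mul_pos hct (hypos 3)) (hypos 1).le
    linarith
  · have := pos_of_mul_pos_left (f3 ▸ mul_pos hct (hypos 1)) (hypos 3).le
    linarith
  · refine mul_right_cancel₀ (mul_pos (hypos 1) (hypos 3)).ne' ?_
    linear_combination (K - Q) * y 3 * f1 + (1 - α + t) * y 3 * f3

end Core

/-! ### Distances after attaching pendant edges and paths -/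

section Distance

theorem SimpleGraph.edist_map_le {V W : Type*} {G : SimpleGraph V} {H : SimpleGraph W}
    (f : G →g H) (x y : V) : H.edist (f x) (f y) ≤ G.edist x y :=
  le_iInf fun p ↦ by simpa using (p.map f).edist_le

theorem SimpleGraph.sub_le_length_of_lipschitz {V : Type*} {G : SimpleGraph V} {φ : V → ℤ}
    (hφ : ∀ x y, G.Adj x y → |φ x - φ y| ≤ 1) {x y : V} (p : G.Walk x y) :
    φ x - φ y ≤ p.length := by
  induction p with
  | nil => simp
  | cons h p ih =>
    have := (abs_le.1 (hφ _ _ h)).2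
    rw [SimpleGraph.Walk.length_cons]
    push_cast
    linarith

/-- Source of all lower bounds for diameters: a 1-Lipschitz potential certifies a distance without
an analysis of walks. Finiteness is needed because `diam` is 0 when `ediam` is infinite. -/
theorem SimpleGraph.sub_le_diam_of_lipschitz {V : Type*} {G : SimpleGraph V}
    (hG : G.ediam ≠ ⊤) {φ : V → ℤ} (hφ : ∀ x y, G.Adj x y → |φ x - φ y| ≤ 1) (x y : V) :
    φ x - φ y ≤ G.diam := by
  have : Nonempty V := ⟨x⟩
  obtain ⟨p, hp⟩ := (SimpleGraph.connected_of_ediam_ne_top hG).exists_walk_length_eq_dist x y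
  have h1 := sub_le_length_of_lipschitz hφ p
  have h2 : G.dist x y ≤ G.diam := SimpleGraph.dist_le_diam hG
  rw [hp] at h1
  exact h1.trans (by exact_mod_cast h2)

/-- The distance of `diamond`. -/
def diamondDist (x y : Fin 4) : ℕ :=
  if x = y then 0 else if (x = 0 ∧ y = 2) ∨ (x = 2 ∧ y = 0) then 2 else 1

theorem diamond_adj {x y : Fin 4} :
    diamond.Adj x y ↔ x ≠ y ∧ ¬ ((x = 0 ∧ y = 2) ∨ (x = 2 ∧ y = 0)) := by
  simp [diamond]

theorem edist_diamond_le (x y : Fin 4) : diamond.edist x y ≤ diamondDist x y := by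
  unfold diamondDist
  split_ifs with h1 h2
  · simp [h1]
  · have e1 : diamond.edist x 1 ≤ 1 :=
      (SimpleGraph.edist_eq_one_iff_adj.2 (diamond_adj.2 (by rcases h2 with ⟨rfl, rfl⟩ | ⟨rfl, rfl⟩ <;> decide))).le
    have e2 : diamond.edist 1 y ≤ 1 :=
      (SimpleGraph.edist_eq_one_iff_adj.2 (diamond_adj.2 (by rcases h2 with ⟨rfl, rfl⟩ | ⟨rfl, rfl⟩ <;> decide))).le
    exact SimpleGraph.edist_triangle.trans ((add_le_add e1 e2).trans (by norm_num))
  · exact (SimpleGraph.edist_eq_one_iff_adj.2 (diamond_adj.2 ⟨h1, h2⟩)).le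

variable {V : Type*} {G : SimpleGraph V} {v : V} {s l : ℕ}

theorem edist_attachPendants_inl_le (x y : V) :
    (attachPendants G v s).edist (.inl x) (.inl y) ≤ G.edist x y :=
  SimpleGraph.edist_map_le (⟨Sum.inl, fun h ↦ h⟩ : G →g attachPendants G v s) x y

theorem edist_attachPath_inl_le (x y : V) :
    (attachPath G v l).edist (.inl x) (.inl y) ≤ G.edist x y :=
  SimpleGraph.edist_map_le (⟨Sum.inl, fun h ↦ h⟩ : G →g attachPath G v l) x y

theorem edist_attachPendants_root (i : Fin s) :
    (attachPendants G v s).edist (.inr i) (.inl v) ≤ 1 := by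
  have : (attachPendants G v s).Adj (.inr i) (.inl v) := rfl
  exact (SimpleGraph.edist_eq_one_iff_adj.2 this).le

theorem edist_attachPath_inr_add {i k : ℕ} (h : i + k < l) :
    (attachPath G v l).edist (.inr ⟨i, by omega⟩) (.inr ⟨i + k, h⟩) ≤ k := by
  induction k with
  | zero => simp
  | succ k ih =>
    have : (attachPath G v l).Adj (.inr ⟨i + k, by omega⟩) (.inr ⟨i + (k + 1), h⟩) := .inl rfl
    refine SimpleGraph.edist_triangle.trans
      ((add_le_add (ih (by omega)) (SimpleGraph.edist_eq_one_iff_adj.2 this).le).trans ?_)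
    simp

theorem edist_attachPath_inr_inr (i j : Fin l) :
    (attachPath G v l).edist (.inr i) (.inr j) ≤ l := by
  wlog h : (i : ℕ) ≤ j generalizing i j
  · rw [SimpleGraph.edist_comm]
    exact this j i (by omega)
  obtain ⟨k, hk⟩ := Nat.exists_eq_add_of_le h
  have := edist_attachPath_inr_add (G := G) (v := v) (l := l) (i := i) (k := k) (by omega)
  have hj : j = ⟨i + k, by omega⟩ := Fin.ext hk
  rw [hj]
  exact this.trans (by exact_mod_cast (by omega : k ≤ l))

theorem edist_attachPath_root (i : Fin l) :
    (attachPath G v l).edist (.inr i) (.inl v) ≤ l := by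
  have hl : 0 < l := i.pos
  have : (attachPath G v l).Adj (.inl v) (.inr ⟨0, hl⟩) := ⟨rfl, rfl⟩
  rw [SimpleGraph.edist_comm]
  have h1 := edist_attachPath_inr_add (G := G) (v := v) (l := l) (i := 0) (k := i) (by omega)
  have h2 : (attachPath G v l).edist (.inr ⟨0, hl⟩) (.inr i) ≤ (i : ℕ) := by simpa using h1
  refine SimpleGraph.edist_triangle.trans
    ((add_le_add (SimpleGraph.edist_eq_one_iff_adj.2 this).le h2).trans ?_)
  rw [add_comm]
  exact_mod_cast i.2

end Distance

/-! ### Diameters of the three families -/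

section ThetaDiameter

variable {u v : Fin 4} {s a b : ℕ}

theorem ediam_thetaGraph_le {D : ℕ} (h2 : 2 ≤ D) (hs : 0 < s → ∀ x, 1 + diamondDist u x ≤ D)
    (ha : ∀ x, a + diamondDist u x ≤ D) (hb : ∀ x, b + diamondDist v x ≤ D)
    (hsa : 0 < s → a + 1 ≤ D) (hsb : 0 < s → b + (diamondDist v u + 1) ≤ D)
    (hab : b + (diamondDist v u + a) ≤ D) : (thetaGraph u v s a b).ediam ≤ D := by
  have cc : ∀ x y, (thetaGraph u v s a b).edist (.inl (.inl (.inl x))) (.inl (.inl (.inl y))) ≤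
      diamondDist x y := fun x y ↦
    (edist_attachPath_inl_le _ _).trans <| (edist_attachPath_inl_le _ _).trans <|
      (edist_attachPendants_inl_le _ _).trans <| edist_diamond_le x y
  have cp : ∀ i, (thetaGraph u v s a b).edist (.inl (.inl (.inr i))) (.inl (.inl (.inl u))) ≤ 1 :=
    fun i ↦ (edist_attachPath_inl_le _ _).trans <| (edist_attachPath_inl_le _ _).trans <|
      edist_attachPendants_root i
  have ca : ∀ i, (thetaGraph u v s a b).edist (.inl (.inr i)) (.inl (.inl (.inl u))) ≤ a :=
    fun i ↦ (edist_attachPath_inl_le _ _).trans <| edist_attachPath_root i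
  have caa : ∀ i j, (thetaGraph u v s a b).edist (.inl (.inr i)) (.inl (.inr j)) ≤ a :=
    fun i j ↦ (edist_attachPath_inl_le _ _).trans <| edist_attachPath_inr_inr i j
  have cb : ∀ i, (thetaGraph u v s a b).edist (.inr i) (.inl (.inl (.inl v))) ≤ b :=
    fun i ↦ edist_attachPath_root i
  have cbb : ∀ i j, (thetaGraph u v s a b).edist (.inr i) (.inr j) ≤ b :=
    fun i j ↦ edist_attachPath_inr_inr i j
  have hD : ∀ {m : ℕ} {n : ℕ∞}, m ≤ D → n ≤ m → n ≤ D :=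
    fun h h' ↦ h'.trans (by exact_mod_cast h)
  have tri : ∀ {x y z : ThetaVertex s a b} {m n : ℕ}, (thetaGraph u v s a b).edist x y ≤ m →
      (thetaGraph u v s a b).edist y z ≤ n →
      (thetaGraph u v s a b).edist x z ≤ ((m + n : ℕ) : ℕ∞) := fun h h' ↦
    SimpleGraph.edist_triangle.trans ((add_le_add h h').trans (by simp))
  have sym : ∀ {x y : ThetaVertex s a b} {n : ℕ∞}, (thetaGraph u v s a b).edist x y ≤ n →
      (thetaGraph u v s a b).edist y x ≤ n := fun h ↦ SimpleGraph.edist_comm.trans_le h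
  have cp' : ∀ i, (thetaGraph u v s a b).edist (.inl (.inl (.inr i))) (.inl (.inl (.inl u))) ≤
      (1 : ℕ) := fun i ↦ by simpa using cp i
  have hdd : ∀ x y, diamondDist x y ≤ 2 := fun x y ↦ by
    unfold diamondDist
    split_ifs <;> omega
  have pc : ∀ i x, (thetaGraph u v s a b).edist (.inl (.inl (.inr i))) (.inl (.inl (.inl x))) ≤ D :=
    fun i x ↦ hD (hs i.pos x) (tri (cp' i) (cc u x))
  have ac : ∀ i x, (thetaGraph u v s a b).edist (.inl (.inr i)) (.inl (.inl (.inl x))) ≤ D :=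
    fun i x ↦ hD (ha x) (tri (ca i) (cc u x))
  have bc : ∀ i x, (thetaGraph u v s a b).edist (.inr i) (.inl (.inl (.inl x))) ≤ D :=
    fun i x ↦ hD (hb x) (tri (cb i) (cc v x))
  have ap : ∀ i j, (thetaGraph u v s a b).edist (.inl (.inr i)) (.inl (.inl (.inr j))) ≤ D :=
    fun i j ↦ hD (hsa j.pos) (tri (ca i) (sym (cp' j)))
  have bp : ∀ i j, (thetaGraph u v s a b).edist (.inr i) (.inl (.inl (.inr j))) ≤ D :=
    fun i j ↦ hD (hsb j.pos) (tri (cb i) (tri (cc v u) (sym (cp' j))))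
  have ba : ∀ i j, (thetaGraph u v s a b).edist (.inr i) (.inl (.inr j)) ≤ D :=
    fun i j ↦ hD hab (tri (cb i) (tri (cc v u) (sym (ca j))))
  refine SimpleGraph.ediam_le_of_edist_le ?_
  rintro (((x | i) | i) | i) (((y | j) | j) | j)
  · exact hD ((hdd x y).trans h2) (cc x y)
  · exact sym (pc j x)
  · exact sym (ac j x)
  · exact sym (bc j x)
  · exact pc i y
  · exact hD h2 (tri (cp' i) (sym (cp' j)))
  · exact sym (ap j i)
  · exact sym (bp j i)
  · exact ac i y
  · exact ap i j
  · exact hD ((Nat.le_add_right _ _).trans (ha u)) (caa i j)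
  · exact sym (ba j i)
  · exact bc i y
  · exact bp i j
  · exact ba i j
  · exact hD ((Nat.le_add_right _ _).trans (hb u)) (cbb i j)

/-- A function on `thetaGraph u v s a b` that is affine along the pendant paths. -/
def thetaPotential (u v : Fin 4) (φ : Fin 4 → ℤ) (p q r : ℤ) : ThetaVertex s a b → ℤ
  | .inl (.inl (.inl x)) => φ x
  | .inl (.inl (.inr _)) => φ u + p
  | .inl (.inr i) => φ u + q * (i + 1)
  | .inr i => φ v + r * (i + 1)

theorem thetaPotential_lipschitz {φ : Fin 4 → ℤ} {p q r : ℤ}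
    (hφ : ∀ x y, x ≠ y ∧ ¬ ((x = 0 ∧ y = 2) ∨ (x = 2 ∧ y = 0)) → |φ x - φ y| ≤ 1)
    (hp : |p| ≤ 1) (hq : |q| ≤ 1) (hr : |r| ≤ 1) (x y : ThetaVertex s a b)
    (h : (thetaGraph u v s a b).Adj x y) :
    |thetaPotential u v φ p q r x - thetaPotential u v φ p q r y| ≤ 1 := by
  rcases x with ((x | i) | i) | i <;> rcases y with ((y | j) | j) | j
  · exact hφ x y (diamond_adj.1 h)
  · obtain rfl : x = u := h
    simpa [thetaPotential] using hp
  · obtain ⟨h, hj⟩ : (Sum.inl x : Fin 4 ⊕ Fin s) = .inl u ∧ (j : ℕ) = 0 := h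
    obtain rfl := Sum.inl_injective h
    simpa [thetaPotential, hj] using hq
  · obtain ⟨h, hj⟩ : (Sum.inl (Sum.inl x) : (Fin 4 ⊕ Fin s) ⊕ Fin a) = .inl (.inl v) ∧
      (j : ℕ) = 0 := h
    obtain rfl := Sum.inl_injective (Sum.inl_injective h)
    simpa [thetaPotential, hj] using hr
  · obtain rfl : y = u := h
    simpa [thetaPotential] using hp
  · exact h.elim
  · exact absurd h.1 (by simp)
  · exact absurd h.1 (by simp)
  · obtain ⟨h, hj⟩ : (Sum.inl y : Fin 4 ⊕ Fin s) = .inl u ∧ (i : ℕ) = 0 := h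
    obtain rfl := Sum.inl_injective h
    simpa [thetaPotential, hj] using hq
  · exact absurd h.1 (by simp)
  · have h' : (i : ℕ) + 1 = j ∨ (j : ℕ) + 1 = i := h
    simp only [thetaPotential]
    rcases h' with h' | h' <;> rw [← h'] <;> push_cast <;> ring_nf <;> simpa using hq
  · exact absurd h.1 (by simp)
  · obtain ⟨h, hj⟩ : (Sum.inl (Sum.inl y) : (Fin 4 ⊕ Fin s) ⊕ Fin a) = .inl (.inl v) ∧
      (i : ℕ) = 0 := h
    obtain rfl := Sum.inl_injective (Sum.inl_injective h)
    simpa [thetaPotential, hj] using hr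
  · exact absurd h.1 (by simp)
  · exact absurd h.1 (by simp)
  · have h' : (i : ℕ) + 1 = j ∨ (j : ℕ) + 1 = i := h
    simp only [thetaPotential]
    rcases h' with h' | h' <;> rw [← h'] <;> push_cast <;> ring_nf <;> simpa using hr

theorem exists_thetaPotential_left (u v : Fin 4) (φ : Fin 4 → ℤ) (p q r : ℤ) :
    ∃ x : ThetaVertex s a b, thetaPotential u v φ p q r x = φ u + q * a := by
  rcases Nat.eq_zero_or_pos a with rfl | h
  · exact ⟨.inl (.inl (.inl u)), by simp [thetaPotential]⟩
  · refine ⟨.inl (.inr ⟨a - 1, by omega⟩), ?_⟩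
    simp [thetaPotential, Nat.cast_sub (R := ℤ) (n := a) (m := 1) h]

theorem exists_thetaPotential_right (u v : Fin 4) (φ : Fin 4 → ℤ) (p q r : ℤ) :
    ∃ x : ThetaVertex s a b, thetaPotential u v φ p q r x = φ v + r * b := by
  rcases Nat.eq_zero_or_pos b with rfl | h
  · exact ⟨.inl (.inl (.inl v)), by simp [thetaPotential]⟩
  · refine ⟨.inr ⟨b - 1, by omega⟩, ?_⟩
    simp [thetaPotential, Nat.cast_sub (R := ℤ) (n := b) (m := 1) h]

theorem exists_thetaPotential_pendant (u v : Fin 4) (φ : Fin 4 → ℤ) (p q r : ℤ) (h : 0 < s) :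
    ∃ x : ThetaVertex s a b, thetaPotential u v φ p q r x = φ u + p :=
  ⟨.inl (.inl (.inr ⟨0, h⟩)), rfl⟩

theorem exists_thetaPotential_core (u v : Fin 4) (φ : Fin 4 → ℤ) (p q r : ℤ) (z : Fin 4) :
    ∃ x : ThetaVertex s a b, thetaPotential u v φ p q r x = φ z :=
  ⟨.inl (.inl (.inl z)), rfl⟩

theorem sub_le_diam_thetaGraph (hG : (thetaGraph u v s a b).ediam ≠ ⊤) {φ : Fin 4 → ℤ} {p q r : ℤ}
    (hφ : ∀ x y, x ≠ y ∧ ¬ ((x = 0 ∧ y = 2) ∨ (x = 2 ∧ y = 0)) → |φ x - φ y| ≤ 1)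
    (hp : |p| ≤ 1) (hq : |q| ≤ 1) (hr : |r| ≤ 1) {m n : ℤ}
    (hm : ∃ x : ThetaVertex s a b, thetaPotential u v φ p q r x = m)
    (hn : ∃ x : ThetaVertex s a b, thetaPotential u v φ p q r x = n) :
    m - n ≤ (thetaGraph u v s a b).diam := by
  obtain ⟨x, rfl⟩ := hm
  obtain ⟨y, rfl⟩ := hn
  exact SimpleGraph.sub_le_diam_of_lipschitz hG (thetaPotential_lipschitz hφ hp hq hr) x y

theorem diam_eq_of_ediam_le {V : Type*} {G : SimpleGraph V} {D : ℕ} (h : G.ediam ≤ D)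
    (h' : G.ediam ≠ ⊤ → D ≤ G.diam) : G.ediam ≠ ⊤ ∧ G.diam = D :=
  have ht : G.ediam ≠ ⊤ := fun ht ↦ by simp [ht] at h
  ⟨ht, le_antisymm (ENat.toNat_le_of_le_natCast h) (h' ht)⟩

/-- The distant pairs are the two path ends, `w₃` with a path end, and `w₃` with a pendant vertex;
`min s 1` records whether a pendant vertex exists. -/
theorem diam_theta₁ (s a b : ℕ) : (theta₁ s a b).ediam ≠ ⊤ ∧
    (theta₁ s a b).diam = max (a + b) (max (max a b + 2) (min s 1 + 2)) := by
  have hd : ∀ x, diamondDist 0 x ≤ 2 := by decide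
  refine diam_eq_of_ediam_le (ediam_thetaGraph_le ?_ ?_ ?_ ?_ ?_ ?_ ?_) fun ht ↦ ?_
  · omega
  · intro _ x
    have := hd x
    omega
  · intro x
    have := hd x
    omega
  · intro x
    have := hd x
    omega
  · omega
  · have : diamondDist 0 0 = 0 := rfl
    omega
  · have : diamondDist 0 0 = 0 := rfl
    omega
  · have h1 := sub_le_diam_thetaGraph ht (φ := ![0, 1, 2, 1]) (p := -1) (q := -1) (r := -1)
      (by decide) (by decide) (by decide) (by decide) (exists_thetaPotential_core _ _ _ _ _ _ 2)
      (exists_thetaPotential_left _ _ _ _ _ _)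
    have h2 := sub_le_diam_thetaGraph ht (φ := ![0, 1, 2, 1]) (p := -1) (q := -1) (r := -1)
      (by decide) (by decide) (by decide) (by decide) (exists_thetaPotential_core _ _ _ _ _ _ 2)
      (exists_thetaPotential_right _ _ _ _ _ _)
    have h3 := fun h ↦ sub_le_diam_thetaGraph ht (φ := ![0, 1, 2, 1]) (p := -1) (q := -1) (r := -1)
      (by decide) (by decide) (by decide) (by decide) (exists_thetaPotential_core _ _ _ _ _ _ 2)
      (exists_thetaPotential_pendant _ _ _ _ _ _ h)
    -- Constant on `diamond`, falling along one path and rising along the other: this measures the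
    -- distance of the path ends.
    have h4 := sub_le_diam_thetaGraph ht (φ := ![0, 0, 0, 0]) (p := -1) (q := -1) (r := 1)
      (by decide) (by decide) (by decide) (by decide) (exists_thetaPotential_right _ _ _ _ _ _)
      (exists_thetaPotential_left _ _ _ _ _ _)
    simp at h1 h2 h3 h4
    rw [theta₁]
    omega

/-- Independent of `s`: seen from `w₂`, a pendant vertex is no farther than `w₁` or `w₃`. -/
theorem diam_theta₂ (s a b : ℕ) : (theta₂ s a b).ediam ≠ ⊤ ∧
    (theta₂ s a b).diam = max (a + b) (max (max a b + 1) 2) := by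
  have hd : ∀ x, diamondDist 1 x ≤ 1 := by decide
  refine diam_eq_of_ediam_le (ediam_thetaGraph_le ?_ ?_ ?_ ?_ ?_ ?_ ?_) fun ht ↦ ?_
  · omega
  · intro _ x
    have := hd x
    omega
  · intro x
    have := hd x
    omega
  · intro x
    have := hd x
    omega
  · omega
  · have : diamondDist 1 1 = 0 := rfl
    omega
  · have : diamondDist 1 1 = 0 := rfl
    omega
  · have h1 := sub_le_diam_thetaGraph ht (φ := ![1, 0, 1, 1]) (p := -1) (q := -1) (r := -1)
      (by decide) (by decide) (by decide) (by decide) (exists_thetaPotential_core _ _ _ _ _ _ 0)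
      (exists_thetaPotential_left _ _ _ _ _ _)
    have h2 := sub_le_diam_thetaGraph ht (φ := ![1, 0, 1, 1]) (p := -1) (q := -1) (r := -1)
      (by decide) (by decide) (by decide) (by decide) (exists_thetaPotential_core _ _ _ _ _ _ 0)
      (exists_thetaPotential_right _ _ _ _ _ _)
    have h3 := sub_le_diam_thetaGraph ht (φ := ![0, 1, 2, 1]) (p := 0) (q := 0) (r := 0)
      (by decide) (by decide) (by decide) (by decide) (exists_thetaPotential_core _ _ _ _ _ _ 2)
      (exists_thetaPotential_core _ _ _ _ _ _ 0)
    have h4 := sub_le_diam_thetaGraph ht (φ := ![0, 0, 0, 0]) (p := -1) (q := -1) (r := 1)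
      (by decide) (by decide) (by decide) (by decide) (exists_thetaPotential_right _ _ _ _ _ _)
      (exists_thetaPotential_left _ _ _ _ _ _)
    simp at h1 h2 h3 h4
    rw [theta₂]
    omega

theorem diam_theta₃ (s a b : ℕ) : (theta₃ s a b).ediam ≠ ⊤ ∧
    (theta₃ s a b).diam = max (a + b + 1) (max 2 (min s 1 + b + 1)) := by
  have hd : ∀ x, diamondDist 1 x ≤ 1 := by decide
  have hd' : ∀ x, diamondDist 3 x ≤ 1 := by decide
  refine diam_eq_of_ediam_le (ediam_thetaGraph_le ?_ ?_ ?_ ?_ ?_ ?_ ?_) fun ht ↦ ?_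
  · omega
  · intro _ x
    have := hd x
    omega
  · intro x
    have := hd x
    omega
  · intro x
    have := hd' x
    omega
  · omega
  · have : diamondDist 3 1 = 1 := rfl
    omega
  · have : diamondDist 3 1 = 1 := rfl
    omega
  · have h1 := sub_le_diam_thetaGraph ht (φ := ![0, 0, 1, 1]) (p := -1) (q := -1) (r := 1)
      (by decide) (by decide) (by decide) (by decide) (exists_thetaPotential_right _ _ _ _ _ _)
      (exists_thetaPotential_left _ _ _ _ _ _)
    have h2 := fun h ↦ sub_le_diam_thetaGraph ht (φ := ![0, 0, 1, 1]) (p := -1) (q := -1) (r := 1)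
      (by decide) (by decide) (by decide) (by decide) (exists_thetaPotential_right _ _ _ _ _ _)
      (exists_thetaPotential_pendant _ _ _ _ _ _ h)
    have h3 := sub_le_diam_thetaGraph ht (φ := ![0, 1, 2, 1]) (p := 0) (q := 0) (r := 0)
      (by decide) (by decide) (by decide) (by decide) (exists_thetaPotential_core _ _ _ _ _ _ 2)
      (exists_thetaPotential_core _ _ _ _ _ _ 0)
    simp at h1 h2 h3
    rw [theta₃]
    omega

end ThetaDiameter

/-! ### Isomorphisms between members of the families -/

section ThetaIso

theorem SimpleGraph.nonempty_iso_of_injective {V W : Type*} [Fintype V] [Fintype W]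
    {G : SimpleGraph V} {H : SimpleGraph W} (f : V → W) (hf : Function.Injective f)
    (hc : Fintype.card V = Fintype.card W) (h : ∀ x y, H.Adj (f x) (f y) ↔ G.Adj x y) :
    Nonempty (G ≃g H) :=
  ⟨⟨Equiv.ofBijective f ((Fintype.bijective_iff_injective_and_card f).2 ⟨hf, hc⟩),
    fun {x y} ↦ h x y⟩⟩

/-- A pendant path of length `1` is a pendant edge. -/
theorem nonempty_thetaGraph_one_iso (u v : Fin 4) (s b : ℕ) :
    Nonempty (thetaGraph u v s 1 b ≃g thetaGraph u v (s + 1) 0 b) := by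
  refine SimpleGraph.nonempty_iso_of_injective
    (Sum.elim (Sum.elim (Sum.elim (fun z ↦ .inl (.inl (.inl z)))
      fun i ↦ .inl (.inl (.inr i.castSucc))) fun _ ↦ .inl (.inl (.inr (Fin.last s)))) .inr)
    ?_ ?_ ?_
  · rintro (((x | i) | i) | i) (((y | j) | j) | j) h <;> simp at h <;> try simp [h]
    · exact absurd h (Fin.castSucc_lt_last j).ne'
    · exact Subsingleton.elim i j
  · simp
    omega
  · rintro (((x | i) | i) | i) (((y | j) | j) | j) <;>
      simp [thetaGraph, attachPath, attachPendants]

/-- Exchange of the two pendant paths by an automorphism of `diamond`. -/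
theorem nonempty_thetaGraph_swap_iso {u v u' v' : Fin 4} {s : ℕ} (a b : ℕ) (σ : Fin 4 ≃ Fin 4)
    (hσ : ∀ x y, diamond.Adj (σ x) (σ y) ↔ diamond.Adj x y) (hu : σ u = v') (hv : σ v = u')
    (hs : 0 < s → σ u = u') :
    Nonempty (thetaGraph u v s a b ≃g thetaGraph u' v' s b a) := by
  have h1 : ∀ x, σ x = v' ↔ x = u := fun x ↦ by rw [← hu, σ.apply_eq_iff_eq]
  have h2 : ∀ x, σ x = u' ↔ x = v := fun x ↦ by rw [← hv, σ.apply_eq_iff_eq]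
  -- Pendant vertices stay in place while the paths are exchanged, so their presence forces `u = v`.
  have h3 : ∀ (_ : Fin s) x, x = v ↔ x = u := fun i x ↦ by
    rw [← h2, ← hs i.pos, σ.apply_eq_iff_eq]
  refine SimpleGraph.nonempty_iso_of_injective
    (Sum.elim (Sum.elim (Sum.elim (fun z ↦ .inl (.inl (.inl (σ z))))
      fun i ↦ .inl (.inl (.inr i))) .inr) fun i ↦ .inl (.inr i)) ?_ ?_ ?_
  · rintro (((x | i) | i) | i) (((y | j) | j) | j) h <;> simp at h <;> simp [h]
  · simp
    omega
  · rintro (((x | i) | i) | i) (((y | j) | j) | j) <;>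
      simp [thetaGraph, attachPath, attachPendants, hσ, h1, h2]
    · exact h3 j x
    · exact h3 i y

theorem nonempty_theta₃_swap_iso (a b : ℕ) : Nonempty (theta₃ 0 a b ≃g theta₃ 0 b a) :=
  nonempty_thetaGraph_swap_iso a b (Equiv.swap 1 3)
    (fun x y ↦ by rw [diamond_adj, diamond_adj]; decide +revert) (by decide) (by decide)
    fun h ↦ absurd h (lt_irrefl 0)

theorem nonempty_theta₂_swap_iso (s a b : ℕ) : Nonempty (theta₂ s a b ≃g theta₂ s b a) :=
  nonempty_thetaGraph_swap_iso a b (Equiv.refl _) (fun _ _ ↦ Iff.rfl) rfl rfl fun _ ↦ rfl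

theorem theta₂_zero (s a : ℕ) : theta₂ s a 0 = theta₃ s a 0 := by
  ext x y
  rcases x with x | i
  · rcases y with y | j
    · rfl
    · exact j.elim0
  · exact i.elim0

end ThetaIso

/-! ### Comparison at the Perron root of the balanced graph -/

section Comparison

variable {α r : ℝ} {S a₀ b₀ a b : ℕ}

theorem pathWeight_one_pos (h0 : 0 ≤ α) (h1 : α < 1) (hr : 2 < r) : 0 < pathWeight α r 1 := by
  simpa [pathWeight] using pathWeight_strictMono h0 h1 hr zero_lt_one

theorem lt_of_balanced_ne (h0 : 0 ≤ α) (h1 : α < 1) (hr : 2 < r)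
    (hP : S * pathWeight α r 1 + pathWeight α r a₀ < coreGap α r)
    (hQ : pathWeight α r b₀ < coreGap α r)
    (heq : (coreGap α r - (S * pathWeight α r 1 + pathWeight α r a₀)) *
      (coreGap α r - pathWeight α r b₀) = (1 - α + coreShift α r) ^ 2)
    (hab : a + b = a₀ + b₀) (hle : b₀ ≤ a₀) (hle' : a₀ ≤ b₀ + 1) (hne : a ≠ a₀)
    (hswap : a = b₀ → 0 < S) :
    S * pathWeight α r 1 + pathWeight α r a < coreGap α r ∧
      (1 - α + coreShift α r) ^ 2 < (coreGap α r - (S * pathWeight α r 1 + pathWeight α r a)) *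
        (coreGap α r - pathWeight α r b) := by
  have hf := pathWeight_one_pos h0 h1 hr
  have ht := coreShift_pos h1 hr
  have hc : (1 - α) ^ 2 ≤ (1 - α + coreShift α r) ^ 2 :=
    pow_le_pow_left₀ (by linarith) (by linarith) 2
  have hS : 0 ≤ (S : ℝ) * pathWeight α r 1 := mul_nonneg (Nat.cast_nonneg S) hf.le
  have := lt_mul_of_unbalanced (L := coreGap α r - S * pathWeight α r 1) h0 h1 hr
    (coreGap_lt h0 h1 hr) (by linarith) (by linarith) hQ (by rw [sub_sub, heq]; exact hc)
    hab hle hle' hne fun h ↦ by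
      have : 0 < (S : ℝ) * pathWeight α r 1 := mul_pos (Nat.cast_pos.2 (hswap h)) hf
      linarith
  rw [sub_sub, sub_sub, heq] at this
  exact ⟨by linarith, this.2⟩

/-- Lets an arbitrary `Θ₃` with the same `S` and `a + b` serve as intermediate term for `Θ₁` and
`Θ₂`: only its inequality at `r` is needed, not its own Perron root. -/
theorem le_of_balanced (h0 : 0 ≤ α) (h1 : α < 1) (hr : 2 < r)
    (hP : S * pathWeight α r 1 + pathWeight α r a₀ < coreGap α r)
    (hQ : pathWeight α r b₀ < coreGap α r)
    (heq : (coreGap α r - (S * pathWeight α r 1 + pathWeight α r a₀)) *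
      (coreGap α r - pathWeight α r b₀) = (1 - α + coreShift α r) ^ 2)
    (hab : a + b = a₀ + b₀) (hle : b₀ ≤ a₀) (hle' : a₀ ≤ b₀ + 1) :
    S * pathWeight α r 1 + pathWeight α r a < coreGap α r ∧ pathWeight α r b < coreGap α r ∧
      (1 - α + coreShift α r) ^ 2 ≤ (coreGap α r - (S * pathWeight α r 1 + pathWeight α r a)) *
        (coreGap α r - pathWeight α r b) := by
  by_cases hne : a = a₀
  · obtain rfl : b = b₀ := by omega
    subst hne
    exact ⟨hP, hQ, heq.ge⟩
  by_cases hswap : a = b₀ ∧ S = 0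
  · obtain ⟨rfl, rfl⟩ := hswap
    obtain rfl : b = a₀ := by omega
    simp only [Nat.cast_zero, zero_mul, zero_add] at *
    exact ⟨hQ, hP, by rw [mul_comm, heq]⟩
  obtain ⟨h2, h3⟩ := lt_of_balanced_ne h0 h1 hr hP hQ heq hab hle hle' hne (by omega)
  refine ⟨h2, ?_, h3.le⟩
  have := pos_of_mul_pos_right ((sq_nonneg _).trans_lt h3) (sub_pos.2 h2).le
  linarith

theorem connected_theta₁ (s a b : ℕ) : (theta₁ s a b).Connected :=
  have : Nonempty (ThetaVertex s a b) := ⟨.inl (.inl (.inl 0))⟩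
  SimpleGraph.connected_of_ediam_ne_top (diam_theta₁ s a b).1

theorem connected_theta₂ (s a b : ℕ) : (theta₂ s a b).Connected :=
  have : Nonempty (ThetaVertex s a b) := ⟨.inl (.inl (.inl 0))⟩
  SimpleGraph.connected_of_ediam_ne_top (diam_theta₂ s a b).1

theorem connected_theta₃ (s a b : ℕ) : (theta₃ s a b).Connected :=
  have : Nonempty (ThetaVertex s a b) := ⟨.inl (.inl (.inl 0))⟩
  SimpleGraph.connected_of_ediam_ne_top (diam_theta₃ s a b).1

theorem theta₃_lt_or_iso_of_add_eq (h0 : 0 ≤ α) (h1 : α < 1) (hab : a + b = a₀ + b₀)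
    (hle : b₀ ≤ a₀) (hle' : a₀ ≤ b₀ + 1) :
    alphaSpectralRadius α (theta₃ S a b) < alphaSpectralRadius α (theta₃ S a₀ b₀) ∨
      Nonempty (theta₃ S a b ≃g theta₃ S a₀ b₀) := by
  by_cases hne : a = a₀
  · obtain rfl : b = b₀ := by omega
    subst hne
    exact .inr ⟨SimpleGraph.Iso.refl⟩
  by_cases hswap : a = b₀ ∧ S = 0
  · obtain ⟨rfl, rfl⟩ := hswap
    obtain rfl : b = a₀ := by omega
    exact .inr (nonempty_theta₃_swap_iso _ _)
  obtain ⟨r, hr, hρ, hP, hQ, heq⟩ := exists_perron_theta₃ h0 h1 (connected_theta₃ S a₀ b₀)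
  obtain ⟨h2, h3⟩ := lt_of_balanced_ne h0 h1 hr hP hQ heq hab hle hle' hne (by omega)
  rw [hρ]
  exact .inl (alphaSpectralRadius_theta₃_lt h0 h1 hr (connected_theta₃ _ _ _) h2 h3)

/-- The pair of weights of `theta₂ s a b` against that of `theta₃ (s + 1) a (b - 1)`. -/
theorem theta₂_weights_lt (h0 : 0 ≤ α) (h1 : α < 1) (hr : 2 < r) {s : ℕ}
    (hP : (s + 1 : ℕ) * pathWeight α r 1 + pathWeight α r a < coreGap α r)
    (hQ : pathWeight α r (b + 1) < coreGap α r)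
    (hle : (1 - α + coreShift α r) ^ 2 ≤
      (coreGap α r - ((s + 1 : ℕ) * pathWeight α r 1 + pathWeight α r a)) *
        (coreGap α r - pathWeight α r (b + 1))) :
    s * pathWeight α r 1 + pathWeight α r a + pathWeight α r (b + 2) < coreGap α r ∧
      (1 - α + coreShift α r) ^ 2 <
        (coreGap α r - (s * pathWeight α r 1 + pathWeight α r a + pathWeight α r (b + 2))) *
          coreGap α r := by
  have ht := coreShift_pos h1 hr
  have hc : (1 - α) ^ 2 ≤ (1 - α + coreShift α r) ^ 2 :=
    pow_le_pow_left₀ (by linarith) (by linarith) 2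
  have hq : 0 < pathWeight α r (b + 1) := by
    simpa [pathWeight] using pathWeight_strictMono h0 h1 hr (Nat.succ_pos b)
  have := lt_sub_mul_of_add (sub_pos.2 hP) hq hQ (coreGap_lt h0 h1 hr)
    (pow_pos (by linarith : 0 < 1 - α) 2) (hc.trans hle)
  -- `f_{b+2} - f_1` is the loss in `lt_sub_mul_of_add` with `q = f_{b+1}`.
  have e : s * pathWeight α r 1 + pathWeight α r a + pathWeight α r (b + 2) =
      (s + 1 : ℕ) * pathWeight α r 1 + pathWeight α r a +
        ((1 - α) ^ 2 / (r - α - pathWeight α r (b + 1)) - (1 - α) ^ 2 / (r - α)) := by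
    rw [pathWeight.eq_2 α r (b + 1), pathWeight_one]
    push_cast
    ring
  rw [e, ← sub_sub]
  exact ⟨by linarith, by linarith⟩

theorem theta₂_lt (h0 : 0 ≤ α) (h1 : α < 1) {s : ℕ} (hab : a + (b + 1) = a₀ + b₀)
    (hle : b₀ ≤ a₀) (hle' : a₀ ≤ b₀ + 1) :
    alphaSpectralRadius α (theta₂ s a (b + 2)) <
      alphaSpectralRadius α (theta₃ (s + 1) a₀ b₀) := by
  obtain ⟨r, hr, hρ, hP, hQ, heq⟩ := exists_perron_theta₃ h0 h1 (connected_theta₃ (s + 1) a₀ b₀)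
  obtain ⟨h2, h3, h4⟩ := le_of_balanced h0 h1 hr hP hQ heq hab hle hle'
  obtain ⟨h5, h6⟩ := theta₂_weights_lt h0 h1 hr h2 h3 h4
  rw [hρ]
  exact alphaSpectralRadius_theta₂_lt h0 h1 hr (connected_theta₂ _ _ _) h5 h6

theorem coreGap_add (α r : ℝ) : coreGap α r + 2 * α + coreShift α r = r - α := by
  rw [coreGap]
  ring

theorem theta₁_lt_of_two_paths (h0 : 0 ≤ α) (h1 : α < 1) {s : ℕ} (hab : a + (b + 1) = a₀ + b₀)
    (hle : b₀ ≤ a₀) (hle' : a₀ ≤ b₀ + 1) :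
    alphaSpectralRadius α (theta₁ s a (b + 2)) <
      alphaSpectralRadius α (theta₃ (s + 1) a₀ b₀) := by
  obtain ⟨r, hr, hρ, hP, hQ, heq⟩ := exists_perron_theta₃ h0 h1 (connected_theta₃ (s + 1) a₀ b₀)
  obtain ⟨h2, h3, h4⟩ := le_of_balanced h0 h1 hr hP hQ heq hab hle hle'
  obtain ⟨h5, h6⟩ := theta₂_weights_lt h0 h1 hr h2 h3 h4
  have hpos : 0 < s * pathWeight α r 1 + pathWeight α r a + pathWeight α r (b + 2) := by
    have := mul_nonneg (Nat.cast_nonneg (α := ℝ) s) (pathWeight_one_pos h0 h1 hr).le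
    have := (pathWeight_nonneg_lt_one h0 h1 hr a).1
    have := pathWeight_strictMono h0 h1 hr (by omega : 0 < b + 2)
    rw [pathWeight] at this
    linarith
  obtain ⟨h7, h8⟩ := two_mul_sq_lt_of_sq_le h0 h1 (coreShift_pos h1 hr) (coreShift_mul h1 hr)
    hpos h5 h6.le
  rw [hρ]
  exact alphaSpectralRadius_theta₁_lt h0 h1 hr (connected_theta₁ _ _ _) rfl h7 h8

/-- For `Θ₁` with at most one path of length 2 or more. Stating `hw` in weights lets pendant edges
be read as paths of length 1, without isomorphisms. -/
theorem theta₁_lt_of_one_path (h0 : 0 ≤ α) (h1 : α < 1) {s m : ℕ}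
    (hw : ∀ r, s * pathWeight α r 1 + pathWeight α r a + pathWeight α r b =
      S * pathWeight α r 1 + pathWeight α r (m + 1) + pathWeight α r 1)
    (hab : m + 1 + 1 = a₀ + b₀) (hle : b₀ ≤ a₀) (hle' : a₀ ≤ b₀ + 1) :
    alphaSpectralRadius α (theta₁ s a b) < alphaSpectralRadius α (theta₃ S a₀ b₀) := by
  obtain ⟨r, hr, hρ, hP, hQ, heq⟩ := exists_perron_theta₃ h0 h1 (connected_theta₃ S a₀ b₀)
  obtain ⟨h2, h3, h4⟩ := le_of_balanced h0 h1 hr hP hQ heq hab hle hle'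
  have hS := mul_nonneg (Nat.cast_nonneg (α := ℝ) S) (pathWeight_one_pos h0 h1 hr).le
  have hm := (pathWeight_strictMono h0 h1 hr).monotone (Nat.le_add_left 1 m)
  have hM : 0 < r - α := by linarith
  have hh : (1 - α) ^ 2 / (r - α) * (coreGap α r + 2 * α + coreShift α r) = (1 - α) ^ 2 := by
    rw [coreGap_add, div_mul_cancel₀ _ hM.ne']
  rw [pathWeight_one] at hm h4
  rw [← pathWeight_one (α := α) (r := r)] at h4
  obtain ⟨h7, h8⟩ := two_mul_sq_lt_of_sq_le_pendant h0 h1 (coreShift_pos h1 hr)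
    (coreShift_mul h1 hr) hh (div_pos (pow_pos (by linarith) 2) hM)
    (P := S * pathWeight α r 1 + pathWeight α r (m + 1)) (by linarith) h2
    (by rw [← pathWeight_one (α := α) (r := r)]; exact h4)
  rw [hρ]
  rw [← pathWeight_one (α := α) (r := r)] at h8
  exact alphaSpectralRadius_theta₁_lt h0 h1 hr (connected_theta₁ _ _ _) (hw r) h7 h8

end Comparison

/-! ### From parameters to the extremal graph -/

section Dichotomy

/-- `G` is isomorphic to `H`, or has smaller `α`-spectral radius. -/
def LtOrIso (α : ℝ) {V W : Type*} [Fintype V] [Fintype W] (G : SimpleGraph V)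
    (H : SimpleGraph W) : Prop :=
  alphaSpectralRadius α G < alphaSpectralRadius α H ∨ Nonempty (G ≃g H)

theorem LtOrIso.of_iso {α : ℝ} {U V W : Type*} [Fintype U] [Fintype V] [Fintype W]
    {F : SimpleGraph U} {G : SimpleGraph V} {H : SimpleGraph W} (e : Nonempty (F ≃g G))
    (h : LtOrIso α G H) : LtOrIso α F H := by
  obtain ⟨e⟩ := e
  rcases h with h | ⟨⟨e'⟩⟩
  · exact .inl ((alphaSpectralRadius_eq_of_iso e).trans_lt h)
  · exact .inr ⟨e.trans e'⟩

variable {α : ℝ} {n d s a b : ℕ}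

theorem theta₃_ltOrIso (h0 : 0 ≤ α) (h1 : α < 1) (hd : 2 ≤ d) (hn : d + 3 ≤ n)
    (hc : s + a + b + 4 = n) (hdiam : max (a + b + 1) (max 2 (min s 1 + b + 1)) = d) :
    LtOrIso α (theta₃ s a b) (B₃Star n d) := by
  -- Here a pendant edge at `w₂` realizes the diameter `b + 2`; it is promoted to a path of length
  -- 1.
  by_cases h : a = 0 ∧ 0 < s
  · obtain ⟨rfl, hs⟩ := h
    obtain ⟨s, rfl⟩ : ∃ t, s = t + 1 := ⟨s - 1, by omega⟩
    refine LtOrIso.of_iso ((nonempty_thetaGraph_one_iso 1 3 s b).map SimpleGraph.Iso.symm) ?_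
    obtain rfl : s = n - (d + 3) := by omega
    exact theta₃_lt_or_iso_of_add_eq h0 h1 (by omega) (by omega) (by omega)
  · obtain rfl : s = n - (d + 3) := by omega
    exact theta₃_lt_or_iso_of_add_eq h0 h1 (by omega) (by omega) (by omega)

theorem theta₂_ltOrIso (h0 : 0 ≤ α) (h1 : α < 1) (hd : 2 ≤ d) (hn : d + 3 ≤ n)
    (hc : s + a + b + 4 = n) (hdiam : max (a + b) (max (max a b + 1) 2) = d) :
    LtOrIso α (theta₂ s a b) (B₃Star n d) := by
  wlog hba : b ≤ a generalizing a b
  · exact LtOrIso.of_iso (nonempty_theta₂_swap_iso s a b) (this (by omega) (by omega) (by omega))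
  have key : ∀ t, t + a + 0 + 4 = n → b ≤ 1 → LtOrIso α (theta₂ t a 0) (B₃Star n d) := by
    intro t ht hb
    rw [theta₂_zero]
    exact theta₃_ltOrIso h0 h1 hd hn ht (by omega)
  -- For `b ≤ 1` the graph is a `Θ₃` with empty second path. For `b ≥ 2` the diameter is `a + b`,
  -- which leaves `B₃*` one more pendant edge.
  rcases b with _ | _ | b
  · exact key s hc zero_le_one
  · exact LtOrIso.of_iso (nonempty_theta₂_swap_iso s a 1) <|
      LtOrIso.of_iso (nonempty_thetaGraph_one_iso 1 1 s a) <|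
      LtOrIso.of_iso (nonempty_theta₂_swap_iso (s + 1) 0 a) (key (s + 1) (by omega) le_rfl)
  · have hS : n - (d + 3) = s + 1 := by omega
    refine .inl ?_
    rw [B₃Star, hS]
    exact theta₂_lt h0 h1 (by omega) (by omega) (by omega)

theorem nonempty_theta₁_swap_iso (s a b : ℕ) : Nonempty (theta₁ s a b ≃g theta₁ s b a) :=
  nonempty_thetaGraph_swap_iso a b (Equiv.refl _) (fun _ _ ↦ Iff.rfl) rfl rfl fun _ ↦ rfl

theorem theta₁_ltOrIso (h0 : 0 ≤ α) (h1 : α < 1) (hn : d + 3 ≤ n)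
    (hc : s + a + b + 4 = n) (hdiam : max (a + b) (max (max a b + 2) (min s 1 + 2)) = d) :
    LtOrIso α (theta₁ s a b) (B₃Star n d) := by
  wlog hba : b ≤ a generalizing a b
  · exact LtOrIso.of_iso (nonempty_theta₁_swap_iso s a b) (this (by omega) (by omega) (by omega))
  refine .inl ?_
  rw [B₃Star]
  -- If there are fewer than two paths, the condition `d + 3 ≤ n` supplies the pendant edges that
  -- stand in for the missing ones.
  rcases b with _ | _ | b
  · rcases a with _ | a
    · refine theta₁_lt_of_one_path h0 h1 (m := 0) (fun r ↦ ?_) (by omega) (by omega) (by omega)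
      obtain ⟨t, rfl⟩ : ∃ t, s = t + 2 := ⟨s - 2, by omega⟩
      have : n - (d + 3) = t := by omega
      rw [this, pathWeight.eq_1]
      push_cast
      ring
    · refine theta₁_lt_of_one_path h0 h1 (m := a) (fun r ↦ ?_) (by omega) (by omega) (by omega)
      obtain ⟨t, rfl⟩ : ∃ t, s = t + 1 := ⟨s - 1, by omega⟩
      have : n - (d + 3) = t := by omega
      rw [this, pathWeight.eq_1]
      push_cast
      ring
  · obtain ⟨a, rfl⟩ : ∃ t, a = t + 1 := ⟨a - 1, by omega⟩
    refine theta₁_lt_of_one_path h0 h1 (m := a) (fun r ↦ ?_) (by omega) (by omega) (by omega)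
    have : n - (d + 3) = s := by omega
    rw [this]
  · have hS : n - (d + 3) = s + 1 := by omega
    rw [hS]
    exact theta₁_lt_of_two_paths h0 h1 (by omega) (by omega) (by omega)

theorem SimpleGraph.Iso.ediam_eq {V W : Type*} {G : SimpleGraph V} {H : SimpleGraph W}
    (e : G ≃g H) : G.ediam = H.ediam := by
  refine le_antisymm ?_ ?_ <;> refine SimpleGraph.ediam_le_of_edist_le fun x y ↦ ?_
  · have := SimpleGraph.edist_map_le e.symm.toHom (e x) (e y)
    simp at this
    exact this.trans SimpleGraph.edist_le_ediam
  · have := SimpleGraph.edist_map_le e.toHom (e.symm x) (e.symm y)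
    simp at this
    exact this.trans SimpleGraph.edist_le_ediam

theorem card_thetaVertex (s a b : ℕ) : Fintype.card (ThetaVertex s a b) = s + a + b + 4 := by
  simp
  omega

theorem ltOrIso_of_inTheta (h0 : 0 ≤ α) (h1 : α < 1) (hd : 2 ≤ d) (hn : d + 3 ≤ n)
    {V : Type*} [Fintype V] {G : SimpleGraph V} (hG : InTheta n d G) :
    LtOrIso α G (B₃Star n d) := by
  rcases hG with ⟨hc, hdiam, s, a, b, ⟨e⟩⟩ | ⟨hc, hdiam, s, a, b, ⟨e⟩⟩ | ⟨hc, hdiam, s, a, b, ⟨e⟩⟩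
  all_goals
    rw [Fintype.card_congr e.toEquiv, card_thetaVertex] at hc
    rw [SimpleGraph.diam, e.ediam_eq] at hdiam
    refine LtOrIso.of_iso ⟨e⟩ ?_
  · exact theta₁_ltOrIso h0 h1 hn hc ((diam_theta₁ s a b).2.symm.trans hdiam)
  · exact theta₂_ltOrIso h0 h1 hd hn hc ((diam_theta₂ s a b).2.symm.trans hdiam)
  · exact theta₃_ltOrIso h0 h1 hd hn hc ((diam_theta₃ s a b).2.symm.trans hdiam)

end Dichotomy

theorem mainTheorem7 (α : ℝ) (hα₀ : 0 ≤ α) (hα₁ : α < 1) (n d : ℕ) (hd : 2 ≤ d)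
    (hn : d + 3 ≤ n) :
    InFamily theta₃ n d (B₃Star n d) ∧
      ∀ {V : Type*} [Fintype V] (G : SimpleGraph V), InTheta n d G →
        alphaSpectralRadius α G ≤ alphaSpectralRadius α (B₃Star n d) ∧
          (alphaSpectralRadius α G = alphaSpectralRadius α (B₃Star n d) ↔
            Nonempty (G ≃g B₃Star n d)) := by
  refine ⟨⟨?_, ?_, _, _, _, ⟨SimpleGraph.Iso.refl⟩⟩, fun G hG ↦ ?_⟩
  · rw [card_thetaVertex]
    omega
  · rw [B₃Star, (diam_theta₃ _ _ _).2]
    omega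
  · rcases ltOrIso_of_inTheta hα₀ hα₁ hd hn hG with h | ⟨⟨e⟩⟩
    · exact ⟨h.le, fun he ↦ absurd he h.ne,
        fun ⟨e⟩ ↦ absurd (alphaSpectralRadius_eq_of_iso e) h.ne⟩
    · have := alphaSpectralRadius_eq_of_iso (α := α) e
      exact ⟨this.le, fun _ ↦ ⟨e⟩, fun _ ↦ this⟩
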